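/- Let $0<d_2<d_1<1$ and put $z_1=d_1$, $z_2=d_2$, $z_3=1-d_2$, $z_4=1+d_1$. Define $$a_1(t)=\frac{z_2z_4+z_3t}{z_1-t},\qquad a_2(t)=\frac{z_1z_4-z_3t}{z_2+t},\qquad a_3(t)=t,\qquad \psi(t)=\frac{a_3(t)}{a_1(t)^2a_2(t)},$$ $$cf(t,s)=\frac{t-s}{ts\,z_3+z_1z_2z_4},\qquad J_1=\left(\frac{z_1z_4}{z_3},\infty\right),\qquad J_2=(0,z_1).$$ Consider the discrete equation, for $f=(f^m_n)_{m,n\in\mathbb Z}$, $$(1+d_1)f^{m-1}_{n}f^{m+1}_{n+1}=d_1f^{m+1}_{n}f^{m-1}_{n+1}+d_2f^m_{n-1}f^m_{n+2}+(1-d_2)f^m_nf^m_{n+1}\qquad(m,n\in\mathbb Z).\tag{$*$}$$ (1) Let $N\ge 0$ and let $c_i,t_i,s_i$ $(1\le i\le N)$ be real numbers such that, for each $i$, $t_i$ and $s_i$ lie in the same interval, $J_1$ or $J_2$ (which one may depend on $i$), and satisfy the dispersion relation $\psi(t_i)=\psi(s_i)$; suppose also that $t_i\ne s_j$ whenever $i\neq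 j$, so that the quantities $b_{ij}$ below are defined. Then $$f^m_n=\sum_{I\subseteq\{1,\dots,N\}}\ \prod_{i\in I}c_i\frac{\phi(t_i)}{\phi(s_i)}\prod_{i,j\in I,\ i<j}b_{ij},\qquad \phi(t)=\left(\frac{a_3(t)}{a_1(t)}\right)^m a_1(t)^n,\qquad b_{ij}=\frac{cf(t_i,t_j)\,cf(s_i,s_j)}{cf(s_i,t_j)\,cf(t_i,s_j)},$$ satisfies $(*)$. If moreover $c_i>0$ for all $i$, then $f^m_n>0$ for all $m,n\in\mathbb Z$. (2) Each of the intervals $J=J_1$ and $J=J_2$ contains exactly one critical point of $\psi$ (a zero of $\psi'$), and for every $t\in J$ other than this critical point there is a unique $s\in J$ with $s\ne t$ and $\psi(s)=\psi(t)$. (3) For $d_2=0$ (and the same $d_1$), equation $(*)$ is the bilinear discrete KdV equation $(1+d_1)f^{m-1}_{n}f^{m+1}_{n+1}=d_1f^{m+1}_{n}f^{m-1}_{n+1}+f^m_nf^m_{n+1}$. -/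

import Mathlib

namespace DMix

noncomputable section

/-- The coefficients, normalised by two parameters, with `z₁ + z₂ + z₃ - z₄ = 0`. -/
def z₁ (d₁ _d₂ : ℝ) : ℝ := d₁
def z₂ (_d₁ d₂ : ℝ) : ℝ := d₂
def z₃ (_d₁ d₂ : ℝ) : ℝ := 1 - d₂
def z₄ (d₁ _d₂ : ℝ) : ℝ := 1 + d₁

def a₁ (d₁ d₂ t : ℝ) : ℝ := (z₂ d₁ d₂ * z₄ d₁ d₂ + z₃ d₁ d₂ * t) / (z₁ d₁ d₂ - t)
def a₂ (d₁ d₂ t : ℝ) : ℝ := (z₁ d₁ d₂ * z₄ d₁ d₂ - z₃ d₁ d₂ * t) / (z₂ d₁ d₂ + t)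
def a₃ (_d₁ _d₂ t : ℝ) : ℝ := t

def cf (d₁ d₂ t s : ℝ) : ℝ :=
  (t - s) / (t * s * z₃ d₁ d₂ + z₁ d₁ d₂ * z₂ d₁ d₂ * z₄ d₁ d₂)

/-- The coupling factor of the solitons with parameters `(t, s)` and `(t', s')`. -/
def b (d₁ d₂ t s t' s' : ℝ) : ℝ :=
  (cf d₁ d₂ t t' * cf d₁ d₂ s s') / (cf d₁ d₂ s t' * cf d₁ d₂ t s')

def φ (d₁ d₂ : ℝ) (m n : ℤ) (t : ℝ) : ℝ :=
  (a₃ d₁ d₂ t / a₁ d₁ d₂ t) ^ m * a₁ d₁ d₂ t ^ n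

/-- The dispersion function: the dispersion relation is `ψ t = ψ s`. -/
def ψ (d₁ d₂ t : ℝ) : ℝ := a₃ d₁ d₂ t / (a₁ d₁ d₂ t ^ 2 * a₂ d₁ d₂ t)

def J₁ (d₁ d₂ : ℝ) : Set ℝ := Set.Ioi (z₁ d₁ d₂ * z₄ d₁ d₂ / z₃ d₁ d₂)
def J₂ (d₁ d₂ : ℝ) : Set ℝ := Set.Ioo 0 (z₁ d₁ d₂)

/-- The `N`-soliton function `f^m_n`, a sum over all subsets `I` of the `N` indices. -/
def soliton (d₁ d₂ : ℝ) {N : ℕ} (c t s : Fin N → ℝ) (m n : ℤ) : ℝ :=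
  ∑ I : Finset (Fin N),
    (∏ i ∈ I, c i * (φ d₁ d₂ m n (t i) / φ d₁ d₂ m n (s i))) *
      ∏ i ∈ I, ∏ j ∈ I with i < j, b d₁ d₂ (t i) (s i) (t j) (s j)

/-- `f` (first argument `m`, second argument `n`) solves the discrete bilinear equation. -/
def IsSolution (d₁ d₂ : ℝ) (f : ℤ → ℤ → ℝ) : Prop :=
  ∀ m n : ℤ, (1 + d₁) * (f (m - 1) n * f (m + 1) (n + 1)) =
    d₁ * (f (m + 1) n * f (m - 1) (n + 1)) + d₂ * (f m (n - 1) * f m (n + 2)) +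
      (1 - d₂) * (f m n * f m (n + 1))

/-- `f` solves the discrete KdV equation in bilinear form. -/
def IsDiscreteKdVSolution (d₁ : ℝ) (f : ℤ → ℤ → ℝ) : Prop :=
  ∀ m n : ℤ, (1 + d₁) * (f (m - 1) n * f (m + 1) (n + 1)) =
    d₁ * (f (m + 1) n * f (m - 1) (n + 1)) + f m n * f m (n + 1)

end

end DMix

/-! The equation is a two-dimensional reduction of the four-term Miwa (discrete BKP) equation. A
complex number `ω` with `ω² = -z₁z₂z₄/z₃` turns the denominator of `cf` into `z₃(ts - ω²)`, and the
Cayley transform `x ↦ (x - ω)/(x + ω)` turns `cf(t, s)` into a multiple of `(p - q)/(p + q)`. The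
`bᵢⱼ` become BKP soliton interactions, and the directions `z₁`, `-z₂`, `∞` produce the factors `a₁`,
`a₂`, `a₃`.

The Miwa equation (`miwa_of_generic`) rests on `∑ⱼ ∏_{l≠j} (yⱼ + yₗ)/(yⱼ - yₗ) = 1` for an odd
number of nodes (`sum_prod_reflFactor`). For each pair `(I, I')` in the product of two subset sums,
the nodes are the directions and the points of the solitons lying in just one of the sets. The
direction nodes give the terms of the equation. The soliton nodes of `(I ∪ {j}, I')` cancel those of
`(I, I' ∪ {j})` (`residue_cancel`). Coinciding parameters are reached by continuity (`miwa_real`).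
The dispersion relation says that the third shift is twice the first plus the second, so three
lattice directions collapse to `m` and `n`.

For part (2), the numerator of `ψ'/ψ` is a quartic whose sign changes place one root in `J₁`, one in
`J₂` and two on the negative axis. Hence `ψ` is unimodal on each interval, and it falls below each
of its values near both ends.

Unimodality also gives positivity: pairs with equal `ψ` values in one interval are nested and pairs
in different intervals are separated, so every `bᵢⱼ ≥ 0`. The empty subset contributes `1`. -/

namespace DMix

section

open Finset Polynomial

/-! ### Combinatorics of products and sums over subsets -/

/-- Factors common to `I` and `I'` cancel when they are mutually inverse there. -/
theorem prod_sdiff_mul_prod_sdiff {ι M : Type*} [DecidableEq ι] [CommMonoid M]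
    (I I' : Finset ι) (e e' : ι → M) (h : ∀ i ∈ I ∩ I', e i * e' i = 1) :
    (∏ i ∈ I \ I', e i) * ∏ i ∈ I' \ I, e' i = (∏ i ∈ I, e i) * ∏ i ∈ I', e' i := by
  rw [← prod_inter_mul_prod_sdiff I I' e, ← prod_inter_mul_prod_sdiff I' I e', inter_comm I' I,
    mul_mul_mul_comm, ← prod_mul_distrib, prod_congr rfl h, prod_const_one, one_mul]

/-- Subsets containing `j` correspond to subsets avoiding it. -/
theorem sum_mem_eq_sum_insert {ι M : Type*} [Fintype ι] [DecidableEq ι] [AddCommMonoid M]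
    (j : ι) (F : Finset ι → M) :
    ∑ I with j ∈ I, F I = ∑ I with j ∉ I, F (insert j I) :=
  sum_nbij' (fun I => I.erase j) (fun I => insert j I) (by simp) (by simp)
    (fun I hI => insert_erase (by simpa using hI)) (fun I hI => erase_insert (by simpa using hI))
    (fun I hI => by rw [insert_erase (by simpa using hI)])

/-- Puts the sum in a form indexed by `j` and two sets avoiding `j`. Together with `sum_sdiff_right`
it lets the residues before and after moving `j` to the other set be compared term by term. -/
theorem sum_sdiff_left {ι M : Type*} [Fintype ι] [DecidableEq ι] [AddCommMonoid M]
    (F : Finset ι → Finset ι → ι → M) :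
    ∑ I, ∑ I', ∑ j ∈ I \ I', F I I' j =
      ∑ j, ∑ I with j ∉ I, ∑ I' with j ∉ I', F (insert j I) I' j := by
  have h1 : ∀ I I' : Finset ι, ∑ j ∈ I \ I', F I I' j =
      ∑ j, if j ∈ I then (if j ∉ I' then F I I' j else 0) else 0 := by
    intro I I'
    rw [← sum_filter, ← sum_filter]
    exact sum_congr (by ext; simp) fun _ _ => rfl
  simp_rw [h1]
  calc _ = ∑ I, ∑ j, ∑ I', if j ∈ I then (if j ∉ I' then F I I' j else 0) else 0 :=
        sum_congr rfl fun _ _ => sum_comm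
    _ = ∑ j, ∑ I, ∑ I', if j ∈ I then (if j ∉ I' then F I I' j else 0) else 0 := sum_comm
    _ = _ := sum_congr rfl fun j _ => by
        rw [← sum_mem_eq_sum_insert j (fun I => ∑ I' with j ∉ I', F I I' j), sum_filter]
        refine sum_congr rfl fun I _ => ?_
        split_ifs
        · rw [sum_filter]
        · simp

theorem sum_sdiff_right {ι M : Type*} [Fintype ι] [DecidableEq ι] [AddCommMonoid M]
    (F : Finset ι → Finset ι → ι → M) :
    ∑ I, ∑ I', ∑ j ∈ I' \ I, F I I' j =
      ∑ j, ∑ I with j ∉ I, ∑ I' with j ∉ I', F I (insert j I') j := by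
  rw [sum_comm, sum_sdiff_left fun I' I j => F I I' j]
  exact sum_congr rfl fun _ _ => sum_comm

/-! ### Weighted sums over subsets with pair interactions -/

section Tau

variable {F : Type*} [Field F] {N : ℕ}

/-- The product of the interactions of all pairs in `I`. -/
def pairProd (B : Fin N → Fin N → F) (I : Finset (Fin N)) : F :=
  ∏ i ∈ I, ∏ j ∈ I with i < j, B i j

/-- The sum over all subsets `I` of the one-body weights and pair interactions of `I`. -/
def tau (B : Fin N → Fin N → F) (w : Fin N → F) : F :=
  ∑ I : Finset (Fin N), (∏ i ∈ I, w i) * pairProd B I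

/-- The pairs containing `j` split by the order of their members; symmetry of `B` merges the two
kinds into one product. -/
theorem pairProd_insert {B : Fin N → Fin N → F} (hB : ∀ i j, B i j = B j i)
    {I : Finset (Fin N)} {j : Fin N} (hj : j ∉ I) :
    pairProd B (insert j I) = pairProd B I * ∏ i ∈ I, B i j := by
  have hfil : ∀ i ∈ I, ∏ l ∈ insert j I with i < l, B i l =
      (if i < j then B i j else 1) * ∏ l ∈ I with i < l, B i l := by
    intro i _
    rw [prod_filter, prod_insert hj, prod_filter]
  have hj' : ∏ l ∈ insert j I with j < l, B j l = ∏ l ∈ I, if j < l then B l j else 1 := by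
    rw [prod_filter, prod_insert hj, if_neg (lt_irrefl j), one_mul]
    exact prod_congr rfl fun l _ => by rw [hB]
  rw [pairProd, prod_insert hj, prod_congr rfl hfil, hj', prod_mul_distrib, ← mul_assoc,
    ← prod_mul_distrib, mul_comm, pairProd]
  congr 1
  refine prod_congr rfl fun i hi => ?_
  rcases lt_trichotomy i j with h | h | h
  · simp [h, h.not_gt]
  · exact absurd (h ▸ hi) hj
  · simp [h, h.not_gt]

end Tau

/-! ### A partial fraction identity -/

section PartialFraction

variable {F : Type*} [Field F]

open scoped Classical in
/-- The factor `(a + b) / (a - b)`, set to `1` on the diagonal. -/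
noncomputable def reflFactor (a b : F) : F := if a = b then 1 else (a + b) / (a - b)

theorem reflFactor_self (a : F) : reflFactor a a = 1 := if_pos rfl

theorem reflFactor_of_ne {a b : F} (h : a ≠ b) : reflFactor a b = (a + b) / (a - b) := if_neg h

theorem reflFactor_neg_neg (a b : F) : reflFactor (-a) (-b) = reflFactor a b := by
  by_cases h : a = b
  · simp [h, reflFactor_self]
  · rw [reflFactor_of_ne h, reflFactor_of_ne (by simpa using h), ← neg_add, ← neg_sub',
      neg_div_neg_eq]

theorem reflFactor_neg_left (a b : F) : reflFactor (-a) b = reflFactor a (-b) := by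
  rw [← reflFactor_neg_neg, neg_neg]

theorem reflFactor_mul_reflFactor_neg {a b : F} (h : a ≠ b) (h' : a ≠ -b) :
    reflFactor a b * reflFactor a (-b) = 1 := by
  have h1 : a - b ≠ 0 := sub_ne_zero.2 h
  have h2 : a + b ≠ 0 := by rwa [← sub_neg_eq_add, sub_ne_zero]
  rw [reflFactor_of_ne h, reflFactor_of_ne h', sub_neg_eq_add, ← sub_eq_add_neg]
  field_simp

/-- For an odd number of distinct nonzero nodes the products of all `(yⱼ + yₗ) / (yⱼ - yₗ)`
with fixed `j` add up to `1`. -/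
theorem sum_prod_reflFactor [CharZero F] {ι : Type*} (s : Finset ι) (y : ι → F)
    (hinj : Set.InjOn y s) (h0 : ∀ i ∈ s, y i ≠ 0) (hodd : Odd s.card) :
    ∑ j ∈ s, ∏ l ∈ s, reflFactor (y j) (y l) = 1 := by
  classical
  -- The leading terms cancel, so `P` equals its Lagrange interpolant at the nodes, where the second
  -- product vanishes. For an odd number of nodes `P(0) = 2 ∏ yᵢ`, and evaluating the interpolant at
  -- `0` gives the identity.
  set P : F[X] := (∏ i ∈ s, (X + C (y i))) - ∏ i ∈ s, (X - C (y i)) with hP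
  have hd1 : (∏ i ∈ s, (X + C (y i))).degree = (s.card : WithBot ℕ) := by
    rw [degree_prod, sum_congr rfl fun i _ => degree_X_add_C (y i)]; simp
  have hd2 : (∏ i ∈ s, (X - C (y i))).degree = (s.card : WithBot ℕ) := by
    rw [degree_prod, sum_congr rfl fun i _ => degree_X_sub_C (y i)]; simp
  have hm1 : (∏ i ∈ s, (X + C (y i))).Monic := monic_prod_of_monic _ _ fun i _ => monic_X_add_C _
  have hm2 : (∏ i ∈ s, (X - C (y i))).Monic := monic_prod_of_monic _ _ fun i _ => monic_X_sub_C _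
  have hdeg : P.degree < (s.card : WithBot ℕ) := by
    rw [← hd1]
    exact degree_sub_lt_left (hd1.trans hd2.symm) hm1.ne_zero
      (hm1.leadingCoeff.trans hm2.leadingCoeff.symm)
  have hint := Lagrange.eq_interpolate hinj hdeg
  have hev := congrArg (eval 0) hint
  rw [Lagrange.eval_interpolate_not_at_node _ fun i hi => (h0 i hi).symm] at hev
  have hP0 : eval 0 P = 2 * ∏ i ∈ s, y i := by
    simp only [hP, eval_sub, eval_prod, eval_add, eval_X, eval_C, zero_add, zero_sub]
    rw [prod_neg, hodd.neg_one_pow]; ring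
  have hn0 : eval 0 (Lagrange.nodal s y) = - ∏ i ∈ s, y i := by
    rw [Lagrange.eval_nodal]
    simp only [zero_sub]
    rw [prod_neg, hodd.neg_one_pow]; ring
  have hterm : ∀ j ∈ s, Lagrange.nodalWeight s y j * (0 - y j)⁻¹ * eval (y j) P =
      -2 * ∏ l ∈ s, reflFactor (y j) (y l) := by
    intro j hj
    have hz : ∏ i ∈ s, (y j - y i) = 0 := prod_eq_zero hj (sub_self _)
    simp only [hP, eval_sub, eval_prod, eval_add, eval_X, eval_C, hz, sub_zero]
    rw [← mul_prod_erase s _ hj, ← mul_prod_erase s (fun l => reflFactor (y j) (y l)) hj,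
      reflFactor_self, one_mul, Lagrange.nodalWeight]
    have : ∏ l ∈ s.erase j, reflFactor (y j) (y l) =
        (∏ l ∈ s.erase j, (y j - y l)⁻¹) * ∏ l ∈ s.erase j, (y j + y l) := by
      rw [← prod_mul_distrib]
      refine prod_congr rfl fun l hl => ?_
      have hne : y j ≠ y l := fun h => (ne_of_mem_erase hl) (hinj (mem_of_mem_erase hl) hj h.symm)
      rw [reflFactor_of_ne hne, div_eq_mul_inv, mul_comm]
    rw [this]
    have := h0 j hj
    rw [zero_sub]
    field_simp
    ring
  rw [hP0, hn0, sum_congr rfl hterm, ← mul_sum] at hev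
  have hpr : ∏ i ∈ s, y i ≠ 0 := prod_ne_zero_iff.2 h0
  have h2 : (2 : F) * ∏ i ∈ s, y i ≠ 0 := mul_ne_zero two_ne_zero hpr
  refine mul_left_cancel₀ h2 ?_
  linear_combination -hev

end PartialFraction

end

section

open Finset

/-! ### The Miwa equation for the sums over subsets -/

section Miwa

variable {F : Type*} [Field F] {N : ℕ} {K : Type*}

/-- The pair interaction `(p - p')(q - q')(q + p')(p + q') / ((p + p')(q + q')(q - p')(p - q'))`. -/
def coupling (p q p' q' : F) : F :=
  ((p - p') / (p + p') * ((q - q') / (q + q'))) / ((q - p') / (q + p') * ((p - q') / (p + q')))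

theorem coupling_comm (p q p' q' : F) : coupling p q p' q' = coupling p' q' p q := by
  simp only [coupling]
  rw [← neg_sub p' p, ← neg_sub q' q, ← neg_sub p' q, ← neg_sub q' p, add_comm p p',
    add_comm q q', add_comm q p', add_comm p q']
  simp only [neg_div, neg_mul_neg]
  ring

/-- The factor by which the shift in direction `a` multiplies the weight of a soliton. -/
def shiftRatio (a p q : F) : F := (a + p) / (a - p) * ((a - q) / (a + q))

/-- All the points `±αₖ`, `±pᵢ`, `±qᵢ` are distinct, except that `pᵢ = qᵢ` is allowed. -/
structure GenericPoints (α : K → F) (p q : Fin N → F) : Prop where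
  α_ne_zero : ∀ k, α k ≠ 0
  p_ne_zero : ∀ i, p i ≠ 0
  q_ne_zero : ∀ i, q i ≠ 0
  α_inj : ∀ k l, k ≠ l → α k ≠ α l
  p_inj : ∀ i j, i ≠ j → p i ≠ p j
  q_inj : ∀ i j, i ≠ j → q i ≠ q j
  p_ne_q : ∀ i j, i ≠ j → p i ≠ q j
  α_ne_p : ∀ k i, α k ≠ p i
  α_ne_q : ∀ k i, α k ≠ q i
  α_ne_neg_p : ∀ k i, α k ≠ -p i
  α_ne_neg_q : ∀ k i, α k ≠ -q i
  p_ne_neg_p : ∀ i j, p i ≠ -p j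
  q_ne_neg_q : ∀ i j, q i ≠ -q j
  p_ne_neg_q : ∀ i j, p i ≠ -q j

/-- The contribution of a soliton present in the first factor only, at the point `y`. -/
noncomputable def nodeFactor (p q y : F) : F := reflFactor y q * reflFactor y (-p)

/-- Reduces the nodes `-pⱼ`, `-qⱼ`, `-αₖ` to their opposites with `p` and `q` exchanged. -/
theorem nodeFactor_neg (p q y : F) : nodeFactor p q (-y) = nodeFactor q p y := by
  rw [nodeFactor, nodeFactor, reflFactor_neg_left, reflFactor_neg_neg, mul_comm]

/-- This is why solitons present in both factors contribute nothing at the remaining nodes. -/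
theorem nodeFactor_mul_nodeFactor_swap {p q y : F} (h1 : y ≠ p) (h2 : y ≠ -p) (h3 : y ≠ q)
    (h4 : y ≠ -q) : nodeFactor p q y * nodeFactor q p y = 1 := by
  have h := reflFactor_mul_reflFactor_neg h1 h2
  have h' := reflFactor_mul_reflFactor_neg h3 h4
  simp only [nodeFactor]
  linear_combination reflFactor y p * reflFactor y (-p) * h' + h

variable {α : K → F} {p q : Fin N → F}

/-- The coupling is the quotient of the node factors of soliton `i` at the two points of soliton
`j`. Interactions gained or lost when `j` changes sides are therefore absorbed by moving the node
from `q j` to `p j`. -/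
theorem coupling_mul_nodeFactor (h : GenericPoints α p q) {i j : Fin N} (hij : i ≠ j) :
    coupling (p i) (q i) (p j) (q j) * nodeFactor (p i) (q i) (q j) =
      nodeFactor (p i) (q i) (p j) := by
  have h1 := h.p_ne_q i j hij
  have h2 := h.p_ne_q j i hij.symm
  have h3 := h.q_inj j i hij.symm
  have h4 := h.p_ne_neg_q i j
  have h5 := h.p_ne_neg_q j i
  have h6 := h.p_ne_neg_p j i
  have h7 := h.q_ne_neg_q i j
  have h4' : q j ≠ -p i := fun e => h4 (by rw [e, neg_neg])
  simp only [coupling, nodeFactor]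
  rw [reflFactor_of_ne h3, reflFactor_of_ne h4', reflFactor_of_ne h2, reflFactor_of_ne h6]
  have e1 : p i - q j ≠ 0 := sub_ne_zero.2 h1
  have e2 : p j - q i ≠ 0 := sub_ne_zero.2 h2
  have e2' : q i - p j ≠ 0 := sub_ne_zero.2 h2.symm
  have e3 : q j - q i ≠ 0 := sub_ne_zero.2 h3
  have e4 : p i + q j ≠ 0 := by rwa [← sub_neg_eq_add, sub_ne_zero]
  have e4' : q j + p i ≠ 0 := by rwa [add_comm]
  have e5 : p j + q i ≠ 0 := by rwa [← sub_neg_eq_add, sub_ne_zero]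
  have e5' : q i + p j ≠ 0 := by rwa [add_comm]
  have e6 : p j + p i ≠ 0 := by rwa [← sub_neg_eq_add, sub_ne_zero]
  have e6' : p i + p j ≠ 0 := by rwa [add_comm]
  have e7 : q i + q j ≠ 0 := by rwa [← sub_neg_eq_add, sub_ne_zero]
  simp only [sub_neg_eq_add, ← sub_eq_add_neg]
  field_simp
  ring

theorem coupling_mul_nodeFactor_swap (h : GenericPoints α p q) {i j : Fin N} (hij : i ≠ j) :
    coupling (p i) (q i) (p j) (q j) * nodeFactor (q i) (p i) (p j) =
      nodeFactor (q i) (p i) (q j) := by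
  have hc : nodeFactor (p i) (q i) (p j) * nodeFactor (q i) (p i) (p j) = 1 :=
    nodeFactor_mul_nodeFactor_swap (h.p_inj j i hij.symm) (h.p_ne_neg_p j i)
      (h.p_ne_q j i hij.symm) (h.p_ne_neg_q j i)
  have hc' : nodeFactor (p i) (q i) (q j) * nodeFactor (q i) (p i) (q j) = 1 :=
    nodeFactor_mul_nodeFactor_swap (h.p_ne_q i j hij).symm
      (fun e => h.p_ne_neg_q i j (by rw [e, neg_neg])) (h.q_inj j i hij.symm) (h.q_ne_neg_q j i)
  linear_combination (-coupling (p i) (q i) (p j) (q j) * nodeFactor (q i) (p i) (p j)) * hc' +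
    nodeFactor (q i) (p i) (q j) * nodeFactor (q i) (p i) (p j) * coupling_mul_nodeFactor h hij +
    nodeFactor (q i) (p i) (q j) * hc

theorem nodeFactor_neg_α (h : GenericPoints α p q) (k : K) (i : Fin N) :
    nodeFactor (p i) (q i) (-α k) = shiftRatio (α k) (p i) (q i) := by
  rw [nodeFactor_neg, nodeFactor, reflFactor_of_ne (h.α_ne_p k i),
    reflFactor_of_ne (h.α_ne_neg_q k i), shiftRatio, sub_neg_eq_add, ← sub_eq_add_neg]

variable [Fintype K]

/-- The contribution of the shift directions at the point `y`. -/
noncomputable def dirFactor (α : K → F) (y : F) : F := ∏ k, reflFactor y (-α k)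

/-- The same absorption for the shift weight that soliton `j` carries only in the second factor;
`dirFactor_neg_p` treats the opposite nodes. -/
theorem dirFactor_q (h : GenericPoints α p q) (j : Fin N) :
    (∏ k, shiftRatio (α k) (p j) (q j)) * dirFactor α (p j) = dirFactor α (q j) := by
  rw [dirFactor, dirFactor, ← prod_mul_distrib]
  refine prod_congr rfl fun k _ => ?_
  have h1 : α k - p j ≠ 0 := sub_ne_zero.2 (h.α_ne_p k j)
  have h2 : α k + q j ≠ 0 := by rw [← sub_neg_eq_add, sub_ne_zero]; exact h.α_ne_neg_q k j
  have h3 : α k + p j ≠ 0 := by rw [← sub_neg_eq_add, sub_ne_zero]; exact h.α_ne_neg_p k j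
  have h4 : p j + α k ≠ 0 := by rwa [add_comm]
  have h5 : q j + α k ≠ 0 := by rwa [add_comm]
  rw [shiftRatio, reflFactor_of_ne (fun e => h.α_ne_neg_p k j (by rw [e, neg_neg])),
    reflFactor_of_ne (fun e => h.α_ne_neg_q k j (by rw [e, neg_neg]))]
  simp only [sub_neg_eq_add, ← sub_eq_add_neg]
  field_simp
  ring

theorem dirFactor_neg_p (h : GenericPoints α p q) (j : Fin N) :
    (∏ k, shiftRatio (α k) (p j) (q j)) * dirFactor α (-q j) = dirFactor α (-p j) := by
  rw [dirFactor, dirFactor, ← prod_mul_distrib]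
  refine prod_congr rfl fun k _ => ?_
  have h1 : α k - p j ≠ 0 := sub_ne_zero.2 (h.α_ne_p k j)
  have h1' : p j - α k ≠ 0 := sub_ne_zero.2 (h.α_ne_p k j).symm
  have h2 : α k + q j ≠ 0 := by rw [← sub_neg_eq_add, sub_ne_zero]; exact h.α_ne_neg_q k j
  have h3 : q j - α k ≠ 0 := sub_ne_zero.2 (h.α_ne_q k j).symm
  rw [shiftRatio, reflFactor_neg_neg, reflFactor_neg_neg, reflFactor_of_ne (h.α_ne_p k j).symm,
    reflFactor_of_ne (h.α_ne_q k j).symm]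
  field_simp
  ring

/-- The partial fraction identity for the nodes of two disjoint sets `D`, `D'` of solitons. -/
theorem sum_nodes [CharZero F] (h : GenericPoints α p q) (hK : Odd (Fintype.card K))
    {D D' : Finset (Fin N)} (hD : Disjoint D D') (T : F → F)
    (hT : ∀ y, T y = dirFactor α y *
      ((∏ i ∈ D, nodeFactor (p i) (q i) y) * ∏ i ∈ D', nodeFactor (q i) (p i) y)) :
    ∑ k, T (-α k) + (∑ j ∈ D, (T (q j) + T (-p j)) + ∑ j ∈ D', (T (p j) + T (-q j))) = 1 := by
  classical
  let s : Finset (K ⊕ ((Fin N ⊕ Fin N) ⊕ (Fin N ⊕ Fin N))) :=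
    univ.disjSum ((D.disjSum D).disjSum (D'.disjSum D'))
  let y : K ⊕ ((Fin N ⊕ Fin N) ⊕ (Fin N ⊕ Fin N)) → F :=
    Sum.elim (fun k => -α k) (Sum.elim (Sum.elim q fun i => -p i) (Sum.elim p fun i => -q i))
  have hne : ∀ i ∈ D, ∀ j ∈ D', i ≠ j := fun i hi j hj e => disjoint_left.1 hD hi (e ▸ hj)
  obtain ⟨a0, p0, q0, aa, pp, qq, pq, ap, aq, ap', aq', pp', qq', pq'⟩ := h
  -- Solitons of `D` give the nodes `qᵢ`, `-pᵢ`, those of `D'` give `pᵢ`, `-qᵢ`. As the sets are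
  -- disjoint, `pᵢ` and `qᵢ` are never nodes together, so `pᵢ = qᵢ` is harmless.
  have hinj : Set.InjOn y s := by
    rintro (k | (i | i) | (i | i)) hi (l | (j | j) | (j | j)) hj hij <;>
      simp only [s, mem_coe, inr_mem_disjSum, inl_mem_disjSum] at hi hj <;>
      simp only [y, Sum.elim_inl, Sum.elim_inr] at hij <;> grind
  have h0 : ∀ i ∈ s, y i ≠ 0 := by
    rintro (k | (i | i) | (i | i)) _ <;> simp [y, a0, p0, q0]
  have hodd : Odd s.card := by
    have : s.card = Fintype.card K + 2 * (D.card + D'.card) := by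
      simp only [s, card_disjSum, card_univ]; ring
    rw [this]
    exact hK.add_even (even_two_mul _)
  have hTs : ∀ z, ∏ l ∈ s, reflFactor z (y l) = T z := by
    intro z
    simp only [s, y, prod_disjSum, Sum.elim_inl, Sum.elim_inr, hT, dirFactor, nodeFactor,
      prod_mul_distrib]
  have key := sum_prod_reflFactor s y hinj h0 hodd
  simp only [hTs] at key
  simpa only [s, y, sum_disjSum, Sum.elim_inl, Sum.elim_inr, sum_add_distrib, add_assoc] using key

end Miwa

end

/-! ### Proof of the Miwa equation by cancellation of residues -/

section

open Finset

section Miwa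

variable {F : Type*} [Field F] {N : ℕ} {K : Type*} {α : K → F} {p q : Fin N → F}

/-- The pair interactions of `N` solitons. -/
def couplings (p q : Fin N → F) (i j : Fin N) : F := coupling (p i) (q i) (p j) (q j)

theorem prod_couplings_mul_nodeFactor (h : GenericPoints α p q) {I : Finset (Fin N)} {j : Fin N}
    (hj : j ∉ I) : (∏ i ∈ I, couplings p q i j) * ∏ i ∈ I, nodeFactor (p i) (q i) (q j) =
      ∏ i ∈ I, nodeFactor (p i) (q i) (p j) := by
  rw [← prod_mul_distrib]
  exact prod_congr rfl fun i hi => coupling_mul_nodeFactor h fun e => hj (e ▸ hi)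

theorem prod_couplings_mul_nodeFactor_swap (h : GenericPoints α p q) {I : Finset (Fin N)}
    {j : Fin N} (hj : j ∉ I) :
    (∏ i ∈ I, couplings p q i j) * ∏ i ∈ I, nodeFactor (q i) (p i) (p j) =
      ∏ i ∈ I, nodeFactor (q i) (p i) (q j) := by
  rw [← prod_mul_distrib]
  exact prod_congr rfl fun i hi => coupling_mul_nodeFactor_swap h fun e => hj (e ▸ hi)

variable [Fintype K]

/-- The products of node factors occurring in `sum_nodes` for `D = I \ I'` and `D' = I' \ I`. -/
noncomputable def nodeTerm (α : K → F) (p q : Fin N → F) (I I' : Finset (Fin N)) (y : F) : F :=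
  dirFactor α y *
    ((∏ i ∈ I \ I', nodeFactor (p i) (q i) y) * ∏ i ∈ I' \ I, nodeFactor (q i) (p i) y)

theorem nodeTerm_eq (I I' : Finset (Fin N)) (y : F)
    (hy : ∀ i ∈ I ∩ I', nodeFactor (p i) (q i) y * nodeFactor (q i) (p i) y = 1) :
    nodeTerm α p q I I' y = dirFactor α y *
      ((∏ i ∈ I, nodeFactor (p i) (q i) y) * ∏ i ∈ I', nodeFactor (q i) (p i) y) := by
  rw [nodeTerm, prod_sdiff_mul_prod_sdiff I I' (fun i => nodeFactor (p i) (q i) y)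
    (fun i => nodeFactor (q i) (p i) y) hy]

theorem nodeTerm_insert_left {I I' : Finset (Fin N)} {j : Fin N} (hj : j ∉ I) (hj' : j ∉ I') (y : F)
    (hy : ∀ i, i ≠ j → nodeFactor (p i) (q i) y * nodeFactor (q i) (p i) y = 1) :
    nodeTerm α p q (insert j I) I' y = dirFactor α y * (nodeFactor (p j) (q j) y *
      (∏ i ∈ I, nodeFactor (p i) (q i) y) * ∏ i ∈ I', nodeFactor (q i) (p i) y) := by
  rw [nodeTerm_eq _ _ _ fun i hi => hy i fun e => hj' (e ▸ (mem_inter.1 hi).2), prod_insert hj]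

theorem nodeTerm_insert_right {I I' : Finset (Fin N)} {j : Fin N} (hj : j ∉ I) (hj' : j ∉ I')
    (y : F) (hy : ∀ i, i ≠ j → nodeFactor (p i) (q i) y * nodeFactor (q i) (p i) y = 1) :
    nodeTerm α p q I (insert j I') y = dirFactor α y * ((∏ i ∈ I, nodeFactor (p i) (q i) y) *
      (nodeFactor (q j) (p j) y * ∏ i ∈ I', nodeFactor (q i) (p i) y)) := by
  rw [nodeTerm_eq _ _ _ fun i hi => hy i fun e => hj (e ▸ (mem_inter.1 hi).1), prod_insert hj']

/-- Moving a soliton from the first to the second factor reverses the sign of the residues. -/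
theorem residue_cancel [CharZero F] (h : GenericPoints α p q) (w : Fin N → F)
    {I I' : Finset (Fin N)} {j : Fin N} (hj : j ∉ I) (hj' : j ∉ I') :
    ((∏ i ∈ insert j I, w i) * pairProd (couplings p q) (insert j I)) *
        ((∏ i ∈ I', w i * ∏ k, shiftRatio (α k) (p i) (q i)) * pairProd (couplings p q) I') *
        (nodeTerm α p q (insert j I) I' (q j) + nodeTerm α p q (insert j I) I' (-p j)) +
      ((∏ i ∈ I, w i) * pairProd (couplings p q) I) *
        ((∏ i ∈ insert j I', w i * ∏ k, shiftRatio (α k) (p i) (q i)) *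
          pairProd (couplings p q) (insert j I')) *
        (nodeTerm α p q I (insert j I') (p j) + nodeTerm α p q I (insert j I') (-q j)) = 0 := by
  have hsymm : ∀ i l, couplings p q i l = couplings p q l i := fun i l => coupling_comm _ _ _ _
  have cp : ∀ i, i ≠ j → nodeFactor (p i) (q i) (p j) * nodeFactor (q i) (p i) (p j) = 1 :=
    fun i hij => nodeFactor_mul_nodeFactor_swap (h.p_inj j i hij.symm) (h.p_ne_neg_p j i)
      (h.p_ne_q j i hij.symm) (h.p_ne_neg_q j i)
  have cq : ∀ i, i ≠ j → nodeFactor (p i) (q i) (q j) * nodeFactor (q i) (p i) (q j) = 1 :=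
    fun i hij => nodeFactor_mul_nodeFactor_swap (h.p_ne_q i j hij).symm
      (fun e => h.p_ne_neg_q i j (by rw [e, neg_neg])) (h.q_inj j i hij.symm) (h.q_ne_neg_q j i)
  have cp' : ∀ i, i ≠ j → nodeFactor (p i) (q i) (-p j) * nodeFactor (q i) (p i) (-p j) = 1 :=
    fun i hij => by rw [nodeFactor_neg, nodeFactor_neg, mul_comm, cp i hij]
  have cq' : ∀ i, i ≠ j → nodeFactor (p i) (q i) (-q j) * nodeFactor (q i) (p i) (-q j) = 1 :=
    fun i hij => by rw [nodeFactor_neg, nodeFactor_neg, mul_comm, cq i hij]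
  -- The source of the opposite signs: all other factors agree when `q j` before the move is matched
  -- with `p j` after it, and `-p j` with `-q j`.
  have hsign : nodeFactor (q j) (p j) (p j) = -nodeFactor (p j) (q j) (q j) := by
    have e1 : p j ≠ -q j := h.p_ne_neg_q j j
    have e2 : q j ≠ -p j := fun e => e1 (by rw [e, neg_neg])
    rw [nodeFactor, nodeFactor, reflFactor_self, reflFactor_self, reflFactor_of_ne e1,
      reflFactor_of_ne e2, sub_neg_eq_add, sub_neg_eq_add, add_comm (q j) (p j),
      ← sub_eq_add_neg, ← sub_eq_add_neg, one_mul, one_mul, ← neg_sub, neg_div]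
  rw [nodeTerm_insert_left hj hj' _ cq, nodeTerm_insert_left hj hj' _ cp',
    nodeTerm_insert_right hj hj' _ cp, nodeTerm_insert_right hj hj' _ cq',
    pairProd_insert hsymm hj, pairProd_insert hsymm hj', prod_insert hj, prod_insert hj']
  simp only [nodeFactor_neg]
  rw [← dirFactor_q h j, ← dirFactor_neg_p h j, hsign, ← prod_couplings_mul_nodeFactor h hj,
    ← prod_couplings_mul_nodeFactor h hj', ← prod_couplings_mul_nodeFactor_swap h hj,
    ← prod_couplings_mul_nodeFactor_swap h hj']
  ring

/-- The Miwa equation for the sums over subsets, in an odd number of directions. -/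
theorem miwa_of_generic [CharZero F] [DecidableEq K] (h : GenericPoints α p q)
    (hK : Odd (Fintype.card K)) (w : Fin N → F) :
    tau (couplings p q) w *
        tau (couplings p q) (fun i => w i * ∏ k, shiftRatio (α k) (p i) (q i)) =
      ∑ k, (∏ l ∈ univ.erase k, (α k + α l) / (α k - α l)) *
        (tau (couplings p q) (fun i => w i * shiftRatio (α k) (p i) (q i)) *
          tau (couplings p q)
            (fun i => w i * ∏ l ∈ univ.erase k, shiftRatio (α l) (p i) (q i))) := by
  set B := couplings p q with hB
  set r : K → Fin N → F := fun k i => shiftRatio (α k) (p i) (q i) with hr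
  set g : Finset (Fin N) → F := fun I => (∏ i ∈ I, w i) * pairProd B I with hg
  set g' : Finset (Fin N) → F := fun I => (∏ i ∈ I, w i * ∏ k, r k i) * pairProd B I with hg'
  have hswap : ∀ k i, nodeFactor (p i) (q i) (-α k) * nodeFactor (q i) (p i) (-α k) = 1 := by
    intro k i
    rw [nodeFactor_neg, nodeFactor_neg, mul_comm]
    exact nodeFactor_mul_nodeFactor_swap (h.α_ne_p k i) (h.α_ne_neg_p k i) (h.α_ne_q k i)
      (h.α_ne_neg_q k i)
  have hdir : ∀ k, dirFactor α (-α k) = ∏ l ∈ univ.erase k, (α k + α l) / (α k - α l) := by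
    intro k
    simp only [dirFactor, reflFactor_neg_neg]
    rw [← mul_prod_erase univ _ (mem_univ k), reflFactor_self, one_mul]
    exact prod_congr rfl fun l hl => reflFactor_of_ne (h.α_inj k l (ne_of_mem_erase hl).symm)
  -- At the node `-αₖ` the node factors are the shift ratio on `I` and its inverse on `I'`: shift
  -- `k` passes from the second factor to the first.
  have hα : ∀ I I' : Finset (Fin N), ∀ k, g I * g' I' * nodeTerm α p q I I' (-α k) =
      (∏ l ∈ univ.erase k, (α k + α l) / (α k - α l)) *
        (((∏ i ∈ I, w i * r k i) * pairProd B I) *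
          ((∏ i ∈ I', w i * ∏ l ∈ univ.erase k, r l i) * pairProd B I')) := by
    intro I I' k
    have h1 : ∏ i ∈ I', (w i * ∏ l, r l i) * nodeFactor (q i) (p i) (-α k) =
        ∏ i ∈ I', w i * ∏ l ∈ univ.erase k, r l i := by
      refine prod_congr rfl fun i _ => ?_
      have := hswap k i
      rw [nodeFactor_neg_α h] at this
      rw [← mul_prod_erase univ _ (mem_univ k)]
      linear_combination (w i * ∏ l ∈ univ.erase k, r l i) * this
    rw [nodeTerm_eq _ _ _ fun i _ => hswap k i, hdir,
      prod_congr rfl fun i _ => nodeFactor_neg_α h k i]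
    simp only [hg, hg']
    rw [← h1]
    simp only [prod_mul_distrib, hr]
    ring
  have hone : ∀ I I' : Finset (Fin N), g I * g' I' =
      ∑ k, g I * g' I' * nodeTerm α p q I I' (-α k) +
        (∑ j ∈ I \ I', g I * g' I' * (nodeTerm α p q I I' (q j) + nodeTerm α p q I I' (-p j)) +
        ∑ j ∈ I' \ I, g I * g' I' *
          (nodeTerm α p q I I' (p j) + nodeTerm α p q I I' (-q j))) := by
    intro I I'
    have hdisj : Disjoint (I \ I') (I' \ I) := disjoint_sdiff_sdiff
    rw [← mul_sum, ← mul_sum, ← mul_sum, ← mul_add, ← mul_add,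
      sum_nodes h hK hdisj (nodeTerm α p q I I') fun y => rfl, mul_one]
  have hres : ∑ I, ∑ I', ∑ j ∈ I \ I', g I * g' I' *
        (nodeTerm α p q I I' (q j) + nodeTerm α p q I I' (-p j)) +
      ∑ I, ∑ I', ∑ j ∈ I' \ I, g I * g' I' *
        (nodeTerm α p q I I' (p j) + nodeTerm α p q I I' (-q j)) = 0 := by
    rw [sum_sdiff_left fun I I' j => g I * g' I' *
        (nodeTerm α p q I I' (q j) + nodeTerm α p q I I' (-p j)),
      sum_sdiff_right fun I I' j => g I * g' I' *
        (nodeTerm α p q I I' (p j) + nodeTerm α p q I I' (-q j))]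
    simp only [← sum_add_distrib]
    refine sum_eq_zero fun j _ => sum_eq_zero fun I hI => sum_eq_zero fun I' hI' => ?_
    exact residue_cancel h w (mem_filter.1 hI).2 (mem_filter.1 hI').2
  calc tau B w * tau B (fun i => w i * ∏ k, r k i) = ∑ I, ∑ I', g I * g' I' := by
        rw [tau, tau, sum_mul_sum]
    _ = ∑ I, ∑ I', ∑ k, g I * g' I' * nodeTerm α p q I I' (-α k) := by
        rw [sum_congr rfl fun I _ => sum_congr rfl fun I' _ => hone I I']
        simp only [sum_add_distrib]
        rw [hres, add_zero]
    _ = ∑ k, ∑ I, ∑ I', g I * g' I' * nodeTerm α p q I I' (-α k) := by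
        rw [sum_congr rfl fun I _ => sum_comm, sum_comm]
    _ = _ := by
        refine sum_congr rfl fun k _ => ?_
        simp only [hα]
        rw [tau, tau, sum_mul_sum, mul_sum]
        exact sum_congr rfl fun I _ => (mul_sum _ _ _).symm

end Miwa

end

section

open Finset

/-! ### The Miwa equation in the original parameters -/

section Cayley

/-- The Cayley transform sending the involution `x ↦ ω² / x` to `p ↦ -p`. -/
noncomputable def cayley (ω x : ℂ) : ℂ := (x - ω) / (x + ω)

variable {ω x y : ℂ}

theorem cayley_sub (hx : x + ω ≠ 0) (hy : y + ω ≠ 0) :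
    cayley ω x - cayley ω y = 2 * ω * (x - y) / ((x + ω) * (y + ω)) := by
  rw [cayley, cayley, div_sub_div _ _ hx hy]
  ring

theorem cayley_add (hx : x + ω ≠ 0) (hy : y + ω ≠ 0) :
    cayley ω x + cayley ω y = 2 * (x * y - ω ^ 2) / ((x + ω) * (y + ω)) := by
  rw [cayley, cayley, div_add_div _ _ hx hy]
  ring

theorem cayley_ne (hω : ω ≠ 0) (hx : x + ω ≠ 0) (hy : y + ω ≠ 0) (hxy : x ≠ y) :
    cayley ω x ≠ cayley ω y := by
  rw [← sub_ne_zero, cayley_sub hx hy]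
  exact div_ne_zero (mul_ne_zero (mul_ne_zero two_ne_zero hω) (sub_ne_zero.2 hxy))
    (mul_ne_zero hx hy)

theorem cayley_ne_neg (hx : x + ω ≠ 0) (hy : y + ω ≠ 0) (hxy : x * y - ω ^ 2 ≠ 0) :
    cayley ω x ≠ -cayley ω y := by
  rw [← sub_ne_zero, sub_neg_eq_add, cayley_add hx hy]
  exact div_ne_zero (mul_ne_zero two_ne_zero hxy) (mul_ne_zero hx hy)

theorem cayley_sub_div_add (hx : x + ω ≠ 0) (hy : y + ω ≠ 0) :
    (cayley ω x - cayley ω y) / (cayley ω x + cayley ω y) =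
      ω * ((x - y) / (x * y - ω ^ 2)) := by
  rw [cayley_sub hx hy, cayley_add hx hy, div_div_div_cancel_right₀ (mul_ne_zero hx hy), mul_assoc,
    mul_div_mul_left _ _ two_ne_zero, mul_div_assoc]

theorem one_sub_cayley (hx : x + ω ≠ 0) : 1 - cayley ω x = 2 * ω / (x + ω) := by
  rw [cayley, one_sub_div hx]; ring

theorem one_add_cayley (hx : x + ω ≠ 0) : 1 + cayley ω x = 2 * x / (x + ω) := by
  rw [cayley, one_add_div hx]; ring

theorem one_add_cayley_div (hx : x + ω ≠ 0) :
    (1 + cayley ω x) / (1 - cayley ω x) = x / ω := by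
  rw [one_add_cayley hx, one_sub_cayley hx, div_div_div_cancel_right₀ hx,
    mul_div_mul_left _ _ two_ne_zero]

end Cayley

/-- The prescribed square is negative, so `ω` is purely imaginary and the Cayley transform has no
pole at a real point. -/
theorem exists_sqrt_parameter {d₁ d₂ : ℝ} (hd₁ : 0 < d₁) (hd₂ : 0 < d₂) (hd : d₂ < 1) :
    ∃ ω : ℂ, ω ≠ 0 ∧ ω ^ 2 * (1 - d₂) = -(d₁ * d₂ * (1 + d₁)) ∧ ∀ x : ℝ, (x : ℂ) + ω ≠ 0 := by
  have hd' : 0 < 1 - d₂ := sub_pos.2 hd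
  have hK : 0 < d₁ * d₂ * (1 + d₁) / (1 - d₂) := by positivity
  have hs := Real.sqrt_pos.2 hK
  refine ⟨Complex.I * Real.sqrt (d₁ * d₂ * (1 + d₁) / (1 - d₂)), ?_, ?_, fun x hx => ?_⟩
  · exact mul_ne_zero Complex.I_ne_zero (by exact_mod_cast hs.ne')
  · rw [mul_pow, Complex.I_sq, ← Complex.ofReal_pow, Real.sq_sqrt hK.le]
    have : (1 - d₂ : ℂ) ≠ 0 := by exact_mod_cast hd'.ne'
    push_cast
    field_simp
  · have := congrArg Complex.im hx
    simp at this
    exact hs.ne' this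

/-! ### Transport of the Miwa equation to the real parameters -/

section Real

variable {d₁ d₂ : ℝ} {N : ℕ}

theorem ofReal_tau (B : Fin N → Fin N → ℝ) (w : Fin N → ℝ) :
    ((tau B w : ℝ) : ℂ) = tau (fun i j => (B i j : ℂ)) fun i => (w i : ℂ) := by
  simp [tau, pairProd]

theorem cayley_sub_div_add_eq_cf {ω : ℂ} (hd : d₂ < 1)
    (hω : ω ^ 2 * (1 - d₂) = -(d₁ * d₂ * (1 + d₁))) (hne : ∀ x : ℝ, (x : ℂ) + ω ≠ 0) (x y : ℝ) :
    (cayley ω x - cayley ω y) / (cayley ω x + cayley ω y) =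
      ω * (1 - d₂) * (cf d₁ d₂ x y : ℝ) := by
  have h1 : (1 - d₂ : ℂ) ≠ 0 := by exact_mod_cast (sub_pos.2 hd).ne'
  rw [cayley_sub_div_add (hne x) (hne y)]
  simp only [cf, z₁, z₂, z₃, z₄]
  push_cast
  have h2 : (x * y * (1 - d₂) + d₁ * d₂ * (1 + d₁) : ℂ) = (x * y - ω ^ 2) * (1 - d₂) := by
    linear_combination hω
  rw [h2, mul_assoc, ← div_div, mul_div_cancel₀ _ h1]

theorem coupling_cayley {ω : ℂ} (hd : d₂ < 1) (hω0 : ω ≠ 0)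
    (hω : ω ^ 2 * (1 - d₂) = -(d₁ * d₂ * (1 + d₁))) (hne : ∀ x : ℝ, (x : ℂ) + ω ≠ 0)
    (t s t' s' : ℝ) :
    coupling (cayley ω t) (cayley ω s) (cayley ω t') (cayley ω s') = (b d₁ d₂ t s t' s' : ℝ) := by
  have h1 : (1 - d₂ : ℂ) ≠ 0 := by exact_mod_cast (sub_pos.2 hd).ne'
  simp only [coupling, cayley_sub_div_add_eq_cf hd hω hne, b]
  push_cast
  rw [mul_mul_mul_comm _ _ _ (cf d₁ d₂ s s' : ℂ), mul_mul_mul_comm _ _ _ (cf d₁ d₂ t s' : ℂ),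
    mul_div_mul_left _ _ (mul_ne_zero (mul_ne_zero hω0 h1) (mul_ne_zero hω0 h1))]

theorem shiftRatio_cayley {ω : ℂ} (hd : d₂ < 1) (hω0 : ω ≠ 0)
    (hω : ω ^ 2 * (1 - d₂) = -(d₁ * d₂ * (1 + d₁))) (hne : ∀ x : ℝ, (x : ℂ) + ω ≠ 0)
    (a t s : ℝ) :
    shiftRatio (cayley ω a) (cayley ω t) (cayley ω s) =
      (cf d₁ d₂ a s / cf d₁ d₂ a t : ℝ) := by
  have h1 : (1 - d₂ : ℂ) ≠ 0 := by exact_mod_cast (sub_pos.2 hd).ne'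
  rw [shiftRatio, ← inv_div, cayley_sub_div_add_eq_cf hd hω hne,
    cayley_sub_div_add_eq_cf hd hω hne, mul_comm, ← div_eq_mul_inv,
    mul_div_mul_left _ _ (mul_ne_zero hω0 h1)]
  push_cast
  rfl

/-- The direction `1` is the Cayley image of `∞`. -/
theorem shiftRatio_one {ω : ℂ} (hω0 : ω ≠ 0) (hne : ∀ x : ℝ, (x : ℂ) + ω ≠ 0) (t s : ℝ) :
    shiftRatio 1 (cayley ω t) (cayley ω s) = (a₃ d₁ d₂ t / a₃ d₁ d₂ s : ℝ) := by
  rw [shiftRatio, ← inv_div (1 + cayley ω s), one_add_cayley_div (hne t),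
    one_add_cayley_div (hne s), a₃, a₃]
  push_cast
  field_simp

/-- With `cf_neg_z₂`, identifies the shifts in the directions `d₁` and `-d₂` with `a₁` and `a₂`; the
constant prefactors cancel in shift ratios. -/
theorem cf_z₁ (t : ℝ) : cf d₁ d₂ d₁ t = (d₁ * a₁ d₁ d₂ t)⁻¹ := by
  simp only [cf, a₁, z₁, z₂, z₃, z₄]
  rw [mul_inv, inv_div, inv_mul_eq_div, div_div]
  congr 1
  ring

theorem cf_neg_z₂ (t : ℝ) : cf d₁ d₂ (-d₂) t = (-d₂ * a₂ d₁ d₂ t)⁻¹ := by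
  simp only [cf, a₂, z₁, z₂, z₃, z₄]
  rw [mul_inv, inv_div, inv_mul_eq_div, div_div, ← neg_div_neg_eq]
  congr 1 <;> ring

/-- The pair interactions of solitons with parameters `t`, `s`. -/
noncomputable def solitonCouplings (d₁ d₂ : ℝ) (t s : Fin N → ℝ) (i j : Fin N) : ℝ :=
  b d₁ d₂ (t i) (s i) (t j) (s j)

/-- The points at which all the factors `a₁`, `a₂`, `a₃` are regular and nonzero. -/
def IsRegularPoint (d₁ d₂ x : ℝ) : Prop :=
  0 < x ∧ d₁ ≠ x ∧ d₁ * (1 + d₁) - (1 - d₂) * x ≠ 0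

/-- Vanishing of `p + q` means `ts = ω² z₃/z₃ < 0`, which is impossible for positive parameters. The
other conditions are distinctness and regularity of `a₁` and `a₂`. -/
theorem genericPoints_cayley {ω : ℂ} (hd₁ : 0 < d₁) (hd₂ : 0 < d₂) (hd : d₂ < 1) (hω0 : ω ≠ 0)
    (hω : ω ^ 2 * (1 - d₂) = -(d₁ * d₂ * (1 + d₁))) (hne : ∀ x : ℝ, (x : ℂ) + ω ≠ 0)
    {t s : Fin N → ℝ} (ht : ∀ i, IsRegularPoint d₁ d₂ (t i))
    (hs : ∀ i, IsRegularPoint d₁ d₂ (s i)) (htt : ∀ i j, i ≠ j → t i ≠ t j)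
    (hss : ∀ i j, i ≠ j → s i ≠ s j) (hts : ∀ i j, i ≠ j → t i ≠ s j) :
    GenericPoints ![cayley ω d₁, cayley ω (-d₂ : ℝ), 1] (fun i => cayley ω (t i))
      (fun i => cayley ω (s i)) := by
  have hd' : 0 < 1 - d₂ := sub_pos.2 hd
  have hC : ∀ x y : ℝ, x ≠ y → cayley ω x ≠ cayley ω y := fun x y hxy =>
    cayley_ne hω0 (hne x) (hne y) (by exact_mod_cast hxy)
  have hCn : ∀ x y : ℝ, x * y * (1 - d₂) + d₁ * d₂ * (1 + d₁) ≠ 0 →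
      cayley ω x ≠ -cayley ω y := by
    intro x y hxy
    refine cayley_ne_neg (hne x) (hne y) fun h => hxy ?_
    have : (x * y * (1 - d₂) + d₁ * d₂ * (1 + d₁) : ℂ) = 0 := by
      linear_combination hω + (1 - d₂ : ℂ) * h
    exact_mod_cast this
  have hpos : ∀ x y : ℝ, 0 < x → 0 < y → cayley ω x ≠ -cayley ω y := fun x y hx hy =>
    hCn x y (by positivity)
  have h0 : ∀ x : ℝ, cayley ω x ≠ 0 := by
    intro x
    refine div_ne_zero (fun h => hne (-x) ?_) (hne x)
    push_cast
    linear_combination -h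
  have hone : ∀ x : ℝ, (1 : ℂ) ≠ cayley ω x := by
    intro x
    rw [← sub_ne_zero, one_sub_cayley (hne x)]
    exact div_ne_zero (mul_ne_zero two_ne_zero hω0) (hne x)
  have hone' : ∀ x : ℝ, 0 < x → (1 : ℂ) ≠ -cayley ω x := by
    intro x hx
    rw [← sub_ne_zero, sub_neg_eq_add, one_add_cayley (hne x)]
    exact div_ne_zero (mul_ne_zero two_ne_zero (by exact_mod_cast hx.ne')) (hne x)
  have hα : ∀ x, IsRegularPoint d₁ d₂ x → ∀ k : Fin 3,
      (![cayley ω d₁, cayley ω (-d₂ : ℝ), 1] : Fin 3 → ℂ) k ≠ cayley ω x := by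
    rintro x ⟨hx, hx1, -⟩ k
    fin_cases k
    · exact hC _ _ hx1
    · exact hC _ _ (by linarith)
    · exact hone x
  have hα' : ∀ x, IsRegularPoint d₁ d₂ x → ∀ k : Fin 3,
      (![cayley ω d₁, cayley ω (-d₂ : ℝ), 1] : Fin 3 → ℂ) k ≠ -cayley ω x := by
    rintro x ⟨hx, -, hx2⟩ k
    fin_cases k
    · exact hpos _ _ hd₁ hx
    -- The mirror image `ω²/(-d₂)` of the direction `-d₂` is `d₁(1 + d₁)/(1 - d₂)`, the zero of
    -- `a₂`.
    · refine hCn _ _ fun h => hx2 (mul_left_cancel₀ hd₂.ne' ?_)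
      linear_combination h
    · exact hone' x hx
  refine ⟨fun k => ?_, fun i => h0 _, fun i => h0 _, fun k l hkl => ?_,
    fun i j hij => hC _ _ (htt i j hij), fun i j hij => hC _ _ (hss i j hij),
    fun i j hij => hC _ _ (hts i j hij), fun k i => hα _ (ht i) k, fun k i => hα _ (hs i) k,
    fun k i => hα' _ (ht i) k, fun k i => hα' _ (hs i) k,
    fun i j => hpos _ _ (ht i).1 (ht j).1, fun i j => hpos _ _ (hs i).1 (hs j).1,
    fun i j => hpos _ _ (ht i).1 (hs j).1⟩
  · fin_cases k
    exacts [h0 _, h0 _, one_ne_zero]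
  · have h12 := hC d₁ (-d₂) (by linarith)
    have h13 := hone d₁
    have h23 := hone (-d₂)
    fin_cases k <;> fin_cases l
    exacts [absurd rfl hkl, h12, h13.symm, h12.symm, absurd rfl hkl, h23.symm, h13, h23,
      absurd rfl hkl]

/-- The bilinear equation for pairwise distinct parameters. -/
theorem miwa_real_of_injective (hd₁ : 0 < d₁) (hd₂ : 0 < d₂) (hd : d₂ < 1)
    {t s : Fin N → ℝ} (ht : ∀ i, IsRegularPoint d₁ d₂ (t i))
    (hs : ∀ i, IsRegularPoint d₁ d₂ (s i)) (htt : ∀ i j, i ≠ j → t i ≠ t j)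
    (hss : ∀ i j, i ≠ j → s i ≠ s j) (hts : ∀ i j, i ≠ j → t i ≠ s j)
    (w r₁ r₂ r₃ : Fin N → ℝ)
    (hr₁ : ∀ i, r₁ i = a₁ d₁ d₂ (t i) / a₁ d₁ d₂ (s i))
    (hr₂ : ∀ i, r₂ i = a₂ d₁ d₂ (t i) / a₂ d₁ d₂ (s i))
    (hr₃ : ∀ i, r₃ i = a₃ d₁ d₂ (t i) / a₃ d₁ d₂ (s i)) :
    (1 + d₁) * (tau (solitonCouplings d₁ d₂ t s) w *
        tau (solitonCouplings d₁ d₂ t s) fun i => w i * (r₁ i * r₂ i * r₃ i)) =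
      d₁ * (tau (solitonCouplings d₁ d₂ t s) (fun i => w i * r₁ i) *
        tau (solitonCouplings d₁ d₂ t s) fun i => w i * (r₂ i * r₃ i)) +
      d₂ * (tau (solitonCouplings d₁ d₂ t s) (fun i => w i * r₂ i) *
        tau (solitonCouplings d₁ d₂ t s) fun i => w i * (r₁ i * r₃ i)) +
      (1 - d₂) * (tau (solitonCouplings d₁ d₂ t s) (fun i => w i * r₃ i) *
        tau (solitonCouplings d₁ d₂ t s) fun i => w i * (r₁ i * r₂ i)) := by
  obtain ⟨ω, hω0, hω, hne⟩ := exists_sqrt_parameter hd₁ hd₂ hd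
  have h1 : (1 - d₂ : ℂ) ≠ 0 := by exact_mod_cast (sub_pos.2 hd).ne'
  have h4 : (1 + d₁ : ℂ) ≠ 0 := by exact_mod_cast (by positivity : (0 : ℝ) < 1 + d₁).ne'
  have e1 : (d₁ : ℂ) ≠ 0 := by exact_mod_cast hd₁.ne'
  have e2 : (d₂ : ℂ) ≠ 0 := by exact_mod_cast hd₂.ne'
  have key := miwa_of_generic (genericPoints_cayley hd₁ hd₂ hd hω0 hω hne ht hs htt hss hts)
    (by decide) (fun i => (w i : ℂ))
  have hB : couplings (fun i => cayley ω (t i)) (fun i => cayley ω (s i)) =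
      fun i j => ((solitonCouplings d₁ d₂ t s i j : ℝ) : ℂ) := by
    funext i j
    exact coupling_cayley hd hω0 hω hne _ _ _ _
  have hs1 : ∀ i, shiftRatio (cayley ω d₁) (cayley ω (t i)) (cayley ω (s i)) = (r₁ i : ℝ) := by
    intro i
    rw [shiftRatio_cayley hd hω0 hω hne, hr₁, cf_z₁, cf_z₁, inv_div_inv,
      mul_div_mul_left _ _ hd₁.ne']
  have hs2 : ∀ i, shiftRatio (cayley ω (-d₂ : ℝ)) (cayley ω (t i)) (cayley ω (s i)) =
      (r₂ i : ℝ) := by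
    intro i
    rw [shiftRatio_cayley hd hω0 hω hne, hr₂, cf_neg_z₂, cf_neg_z₂, inv_div_inv,
      mul_div_mul_left _ _ (neg_ne_zero.2 hd₂.ne')]
  have hs3 : ∀ i, shiftRatio 1 (cayley ω (t i)) (cayley ω (s i)) = (r₃ i : ℝ) := by
    intro i
    rw [shiftRatio_one (d₁ := d₁) (d₂ := d₂) hω0 hne, hr₃]
  have c12 : (cayley ω d₁ + cayley ω (-d₂ : ℝ)) / (cayley ω d₁ - cayley ω (-d₂ : ℝ)) =
      d₁ * d₂ / (ω * (1 - d₂)) := by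
    have hcf : cf d₁ d₂ d₁ (-d₂) = (d₁ * d₂)⁻¹ := by
      have : d₁ + d₂ ≠ 0 := by positivity
      simp only [cf, z₁, z₂, z₃, z₄]
      -- This is where the linear relation `z₄ - z₃ = z₁ + z₂` enters.
      rw [show d₁ * -d₂ * (1 - d₂) + d₁ * d₂ * (1 + d₁) = (d₁ + d₂) * (d₁ * d₂) by ring,
        sub_neg_eq_add, div_mul_cancel_left₀ this]
    rw [← inv_div, cayley_sub_div_add_eq_cf hd hω hne, hcf]
    push_cast
    field_simp
  have c21 : (cayley ω (-d₂ : ℝ) + cayley ω d₁) / (cayley ω (-d₂ : ℝ) - cayley ω d₁) =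
      -(d₁ * d₂ / (ω * (1 - d₂))) := by
    rw [← c12, add_comm, ← neg_sub (cayley ω d₁), div_neg]
  have c31 := one_add_cayley_div (hne d₁)
  have c32 := one_add_cayley_div (hne (-d₂))
  have c13 : (cayley ω d₁ + 1) / (cayley ω d₁ - 1) = -(d₁ / ω) := by
    rw [← c31, add_comm, ← neg_sub (1 : ℂ), div_neg]
  have c23 : (cayley ω (-d₂ : ℝ) + 1) / (cayley ω (-d₂ : ℝ) - 1) = -((-d₂ : ℝ) / ω) := by
    rw [← c32, add_comm, ← neg_sub (1 : ℂ), div_neg]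
  have E0 : (univ : Finset (Fin 3)).erase 0 = {1, 2} := by decide
  have E1 : (univ : Finset (Fin 3)).erase 1 = {0, 2} := by decide
  have E2 : (univ : Finset (Fin 3)).erase 2 = {0, 1} := by decide
  have n12 : (1 : Fin 3) ≠ 2 := by decide
  have n02 : (0 : Fin 3) ≠ 2 := by decide
  have n01 : (0 : Fin 3) ≠ 1 := by decide
  simp only [Fin.sum_univ_three, Fin.prod_univ_three, E0, E1, E2, prod_pair n12, prod_pair n02,
    prod_pair n01, Matrix.cons_val_zero, Matrix.cons_val_one, Matrix.cons_val, hs1, hs2, hs3, hB,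
    c12, c21, c13, c23, c31, c32, ← Complex.ofReal_mul, ← ofReal_tau] at key
  have hω2 : ω ^ 2 = -(d₁ * d₂ * (1 + d₁)) / (1 - d₂) := by
    rw [← hω]; field_simp
  -- `k1`, `k2`, `k3` compute the three Miwa coefficients, which are those of the bilinear equation
  -- divided by `z₄`.
  have k1 : (d₁ * d₂ : ℂ) / (ω * (1 - d₂)) * -(d₁ / ω) = d₁ / (1 + d₁) := by
    rw [div_mul_eq_mul_div, mul_neg, ← mul_div_assoc, ← neg_div, div_div,
      show ω * (ω * (1 - d₂ : ℂ)) = -(d₁ * d₂ * (1 + d₁)) by rw [← hω]; ring]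
    field_simp
  have k2 : -((d₁ * d₂ : ℂ) / (ω * (1 - d₂))) * -((-d₂ : ℝ) / ω) = d₂ / (1 + d₁) := by
    rw [neg_mul_neg, div_mul_div_comm,
      show ω * (1 - d₂ : ℂ) * ω = -(d₁ * d₂ * (1 + d₁)) by rw [← hω]; ring]
    push_cast
    field_simp
  have k3 : (d₁ / ω : ℂ) * ((-d₂ : ℝ) / ω) = (1 - d₂) / (1 + d₁) := by
    rw [div_mul_div_comm, ← sq, hω2]
    push_cast
    field_simp
  simp only [Complex.ofReal_mul] at key
  rw [k1, k2, k3] at key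
  have key' := congrArg (fun z : ℂ => (1 + d₁) * z) key
  simp only [mul_add, ← mul_assoc, mul_div_cancel₀ _ h4] at key'
  apply Complex.ofReal_injective
  push_cast
  simp only [← mul_assoc]
  simpa only [mul_assoc] using key'

end Real

end

/-! ### Coinciding parameters and the reduction to the two-dimensional lattice -/

section

open Finset Filter Topology

section Solution

variable {d₁ d₂ : ℝ} {N : ℕ}

theorem continuousAt_tau {X : Type*} [TopologicalSpace X] {x₀ : X} {B : X → Fin N → Fin N → ℝ}
    {w : X → Fin N → ℝ} (hB : ∀ i j, i < j → ContinuousAt (fun x => B x i j) x₀)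
    (hw : ∀ i, ContinuousAt (fun x => w x i) x₀) :
    ContinuousAt (fun x => tau (B x) (w x)) x₀ := by
  refine tendsto_finsetSum _ fun I _ => Tendsto.mul ?_ ?_
  · exact tendsto_finsetProd _ fun i _ => hw i
  · exact tendsto_finsetProd _ fun i _ => tendsto_finsetProd _ fun j hj =>
      hB i j (mem_filter.1 hj).2

theorem eventually_add_mul_ne {a a' x x' : ℝ} (hx : x ≠ x') :
    ∀ᶠ ε in 𝓝[≠] (0 : ℝ), a + ε * x ≠ a' + ε * x' := by
  by_cases ha : a = a'
  · subst ha
    filter_upwards [self_mem_nhdsWithin] with ε hε e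
    exact hx (mul_left_cancel₀ hε (add_left_cancel e))
  · refine eventually_nhdsWithin_of_eventually_nhds ?_
    have hc : ContinuousAt (fun ε : ℝ => a + ε * x - (a' + ε * x')) 0 := by fun_prop
    exact (hc.eventually_ne (by simpa [sub_eq_zero] using ha)).mono fun ε h => sub_ne_zero.1 h

theorem IsRegularPoint.z₁_sub_ne {x : ℝ} (h : IsRegularPoint d₁ d₂ x) : z₁ d₁ d₂ - x ≠ 0 :=
  sub_ne_zero.2 h.2.1

theorem IsRegularPoint.a₁_ne (hd₁ : 0 < d₁) (hd₂ : 0 < d₂) (hd : d₂ < 1) {x : ℝ}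
    (h : IsRegularPoint d₁ d₂ x) : a₁ d₁ d₂ x ≠ 0 := by
  have hx := h.1
  have hd' : 0 < 1 - d₂ := sub_pos.2 hd
  refine div_ne_zero ?_ h.z₁_sub_ne
  simp only [z₂, z₃, z₄]
  positivity

theorem IsRegularPoint.a₂_ne (hd₂ : 0 < d₂) {x : ℝ}
    (h : IsRegularPoint d₁ d₂ x) : a₂ d₁ d₂ x ≠ 0 := by
  have hx := h.1
  exact div_ne_zero h.2.2 (by simp only [z₂]; positivity)

theorem IsRegularPoint.eventually {x : ℝ} (h : IsRegularPoint d₁ d₂ x) :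
    ∀ᶠ y in 𝓝 x, IsRegularPoint d₁ d₂ y := by
  refine (lt_mem_nhds h.1).and (((eventually_ne_nhds h.2.1.symm).mono fun _ hy => hy.symm).and ?_)
  have : ContinuousAt (fun y : ℝ => d₁ * (1 + d₁) - (1 - d₂) * y) x := by fun_prop
  exact this.eventually_ne h.2.2

theorem cf_denom_pos (hd₁ : 0 < d₁) (hd₂ : 0 < d₂) (hd : d₂ < 1) {x y : ℝ} (hx : 0 < x)
    (hy : 0 < y) : 0 < x * y * z₃ d₁ d₂ + z₁ d₁ d₂ * z₂ d₁ d₂ * z₄ d₁ d₂ := by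
  have hd' : 0 < 1 - d₂ := sub_pos.2 hd
  simp only [z₁, z₂, z₃, z₄]
  positivity

theorem cf_ne_zero (hd₁ : 0 < d₁) (hd₂ : 0 < d₂) (hd : d₂ < 1) {x y : ℝ} (hx : 0 < x)
    (hy : 0 < y) (hxy : x ≠ y) : cf d₁ d₂ x y ≠ 0 :=
  div_ne_zero (sub_ne_zero.2 hxy) (cf_denom_pos hd₁ hd₂ hd hx hy).ne'

theorem continuousAt_cf (hd₁ : 0 < d₁) (hd₂ : 0 < d₂) (hd : d₂ < 1) {f g : ℝ → ℝ} {x : ℝ}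
    (hf : ContinuousAt f x) (hg : ContinuousAt g x) (hfx : 0 < f x) (hgx : 0 < g x) :
    ContinuousAt (fun y => cf d₁ d₂ (f y) (g y)) x :=
  (hf.sub hg).div (((hf.mul hg).mul continuousAt_const).add continuousAt_const)
    (cf_denom_pos hd₁ hd₂ hd hfx hgx).ne'

theorem continuousAt_a₁ {f : ℝ → ℝ} {x : ℝ} (hf : ContinuousAt f x)
    (h : IsRegularPoint d₁ d₂ (f x)) : ContinuousAt (fun y => a₁ d₁ d₂ (f y)) x :=
  (continuousAt_const.add (continuousAt_const.mul hf)).div (continuousAt_const.sub hf) h.z₁_sub_ne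

theorem continuousAt_a₂ (hd₂ : 0 < d₂) {f : ℝ → ℝ} {x : ℝ} (hf : ContinuousAt f x)
    (h : IsRegularPoint d₁ d₂ (f x)) : ContinuousAt (fun y => a₂ d₁ d₂ (f y)) x :=
  (continuousAt_const.sub (continuousAt_const.mul hf)).div (continuousAt_const.add hf)
    (add_pos hd₂ h.1).ne'

/-- The bilinear equation, with coinciding parameters allowed; it follows from the case of
pairwise distinct parameters by perturbation. -/
theorem miwa_real (hd₁ : 0 < d₁) (hd₂ : 0 < d₂) (hd : d₂ < 1)
    {t s : Fin N → ℝ} (ht : ∀ i, IsRegularPoint d₁ d₂ (t i))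
    (hs : ∀ i, IsRegularPoint d₁ d₂ (s i)) (hts : ∀ i j, i ≠ j → t i ≠ s j)
    (w r₁ r₂ r₃ : Fin N → ℝ)
    (hr₁ : ∀ i, r₁ i = a₁ d₁ d₂ (t i) / a₁ d₁ d₂ (s i))
    (hr₂ : ∀ i, r₂ i = a₂ d₁ d₂ (t i) / a₂ d₁ d₂ (s i))
    (hr₃ : ∀ i, r₃ i = a₃ d₁ d₂ (t i) / a₃ d₁ d₂ (s i)) :
    (1 + d₁) * (tau (solitonCouplings d₁ d₂ t s) w *
        tau (solitonCouplings d₁ d₂ t s) fun i => w i * (r₁ i * r₂ i * r₃ i)) =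
      d₁ * (tau (solitonCouplings d₁ d₂ t s) (fun i => w i * r₁ i) *
        tau (solitonCouplings d₁ d₂ t s) fun i => w i * (r₂ i * r₃ i)) +
      d₂ * (tau (solitonCouplings d₁ d₂ t s) (fun i => w i * r₂ i) *
        tau (solitonCouplings d₁ d₂ t s) fun i => w i * (r₁ i * r₃ i)) +
      (1 - d₂) * (tau (solitonCouplings d₁ d₂ t s) (fun i => w i * r₃ i) *
        tau (solitonCouplings d₁ d₂ t s) fun i => w i * (r₁ i * r₂ i)) := by
  obtain rfl : r₁ = fun i => a₁ d₁ d₂ (t i) / a₁ d₁ d₂ (s i) := funext hr₁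
  obtain rfl : r₂ = fun i => a₂ d₁ d₂ (t i) / a₂ d₁ d₂ (s i) := funext hr₂
  obtain rfl : r₃ = fun i => a₃ d₁ d₂ (t i) / a₃ d₁ d₂ (s i) := funext hr₃
  -- Slopes that differ between solitons separate coinciding parameters for small `ε ≠ 0`. The
  -- perturbation need not preserve the dispersion relation, which the equation with three
  -- independent shifts does not require.
  let T : ℝ → Fin N → ℝ := fun ε i => t i + ε * (i : ℕ)
  let S : ℝ → Fin N → ℝ := fun ε i => s i + ε * (i : ℕ)
  have hT0 : T 0 = t := by funext i; simp [T]
  have hS0 : S 0 = s := by funext i; simp [S]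
  have cT : ∀ i, ContinuousAt (fun ε => T ε i) 0 := fun i => by simp only [T]; fun_prop
  have cS : ∀ i, ContinuousAt (fun ε => S ε i) 0 := fun i => by simp only [S]; fun_prop
  have hT : ∀ i, IsRegularPoint d₁ d₂ (T 0 i) := by rwa [hT0]
  have hS : ∀ i, IsRegularPoint d₁ d₂ (S 0 i) := by rwa [hS0]
  have hTS : ∀ i j, i ≠ j → T 0 i ≠ S 0 j := by rwa [hT0, hS0]
  let R₁ : ℝ → Fin N → ℝ := fun ε i => a₁ d₁ d₂ (T ε i) / a₁ d₁ d₂ (S ε i)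
  let R₂ : ℝ → Fin N → ℝ := fun ε i => a₂ d₁ d₂ (T ε i) / a₂ d₁ d₂ (S ε i)
  let R₃ : ℝ → Fin N → ℝ := fun ε i => a₃ d₁ d₂ (T ε i) / a₃ d₁ d₂ (S ε i)
  have cR₁ : ∀ i, ContinuousAt (fun ε => R₁ ε i) 0 := fun i =>
    (continuousAt_a₁ (cT i) (hT i)).div (continuousAt_a₁ (cS i) (hS i)) ((hS i).a₁_ne hd₁ hd₂ hd)
  have cR₂ : ∀ i, ContinuousAt (fun ε => R₂ ε i) 0 := fun i =>
    (continuousAt_a₂ hd₂ (cT i) (hT i)).div (continuousAt_a₂ hd₂ (cS i) (hS i))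
      ((hS i).a₂_ne hd₂)
  have cR₃ : ∀ i, ContinuousAt (fun ε => R₃ ε i) 0 := fun i => (cT i).div (cS i) (hS i).1.ne'
  have cB : ∀ i j, i < j →
      ContinuousAt (fun ε => solitonCouplings d₁ d₂ (T ε) (S ε) i j) 0 := by
    intro i j hij
    refine ((continuousAt_cf hd₁ hd₂ hd (cT i) (cT j) (hT i).1 (hT j).1).mul
      (continuousAt_cf hd₁ hd₂ hd (cS i) (cS j) (hS i).1 (hS j).1)).div
      ((continuousAt_cf hd₁ hd₂ hd (cS i) (cT j) (hS i).1 (hT j).1).mul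
      (continuousAt_cf hd₁ hd₂ hd (cT i) (cS j) (hT i).1 (hS j).1)) (mul_ne_zero ?_ ?_)
    -- The condition `t i ≠ s j` keeps the coupling denominators nonzero at `ε = 0`; equal `t`'s or
    -- equal `s`'s only make numerators vanish.
    · exact cf_ne_zero hd₁ hd₂ hd (hS i).1 (hT j).1 (hTS j i hij.ne').symm
    · exact cf_ne_zero hd₁ hd₂ hd (hT i).1 (hS j).1 (hTS i j hij.ne)
  have cw : ∀ i, ContinuousAt (fun _ : ℝ => w i) 0 := fun i => continuousAt_const
  let L : ℝ → ℝ := fun ε => (1 + d₁) * (tau (solitonCouplings d₁ d₂ (T ε) (S ε)) w *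
    tau (solitonCouplings d₁ d₂ (T ε) (S ε)) fun i => w i * (R₁ ε i * R₂ ε i * R₃ ε i))
  let R : ℝ → ℝ := fun ε =>
    d₁ * (tau (solitonCouplings d₁ d₂ (T ε) (S ε)) (fun i => w i * R₁ ε i) *
        tau (solitonCouplings d₁ d₂ (T ε) (S ε)) fun i => w i * (R₂ ε i * R₃ ε i)) +
      d₂ * (tau (solitonCouplings d₁ d₂ (T ε) (S ε)) (fun i => w i * R₂ ε i) *
        tau (solitonCouplings d₁ d₂ (T ε) (S ε)) fun i => w i * (R₁ ε i * R₃ ε i)) +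
      (1 - d₂) * (tau (solitonCouplings d₁ d₂ (T ε) (S ε)) (fun i => w i * R₃ ε i) *
        tau (solitonCouplings d₁ d₂ (T ε) (S ε)) fun i => w i * (R₁ ε i * R₂ ε i))
  have cL : ContinuousAt L 0 := continuousAt_const.mul ((continuousAt_tau cB cw).mul
    (continuousAt_tau cB fun i => (cw i).mul (((cR₁ i).mul (cR₂ i)).mul (cR₃ i))))
  have cR : ContinuousAt R 0 :=
    ((continuousAt_const.mul ((continuousAt_tau cB fun i => (cw i).mul (cR₁ i)).mul
      (continuousAt_tau cB fun i => (cw i).mul ((cR₂ i).mul (cR₃ i))))).add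
    (continuousAt_const.mul ((continuousAt_tau cB fun i => (cw i).mul (cR₂ i)).mul
      (continuousAt_tau cB fun i => (cw i).mul ((cR₁ i).mul (cR₃ i)))))).add
    (continuousAt_const.mul ((continuousAt_tau cB fun i => (cw i).mul (cR₃ i)).mul
      (continuousAt_tau cB fun i => (cw i).mul ((cR₁ i).mul (cR₂ i)))))
  have hval : ∀ {i j : Fin N}, i ≠ j → ((i : ℕ) : ℝ) ≠ ((j : ℕ) : ℝ) := fun hij e =>
    hij (Fin.ext (by exact_mod_cast e))
  have hLR : L =ᶠ[𝓝[≠] 0] R := by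
    have e1 : ∀ᶠ ε in 𝓝[≠] (0 : ℝ), ∀ i, IsRegularPoint d₁ d₂ (T ε i) :=
      eventually_all.2 fun i => eventually_nhdsWithin_of_eventually_nhds
        ((cT i).eventually (hT i).eventually)
    have e2 : ∀ᶠ ε in 𝓝[≠] (0 : ℝ), ∀ i, IsRegularPoint d₁ d₂ (S ε i) :=
      eventually_all.2 fun i => eventually_nhdsWithin_of_eventually_nhds
        ((cS i).eventually (hS i).eventually)
    have e3 : ∀ᶠ ε in 𝓝[≠] (0 : ℝ), ∀ i j, i ≠ j → T ε i ≠ T ε j :=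
      eventually_all.2 fun i => eventually_all.2 fun j => eventually_all.2 fun hij =>
        eventually_add_mul_ne (hval hij)
    have e4 : ∀ᶠ ε in 𝓝[≠] (0 : ℝ), ∀ i j, i ≠ j → S ε i ≠ S ε j :=
      eventually_all.2 fun i => eventually_all.2 fun j => eventually_all.2 fun hij =>
        eventually_add_mul_ne (hval hij)
    have e5 : ∀ᶠ ε in 𝓝[≠] (0 : ℝ), ∀ i j, i ≠ j → T ε i ≠ S ε j :=
      eventually_all.2 fun i => eventually_all.2 fun j => eventually_all.2 fun hij =>
        eventually_add_mul_ne (hval hij)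
    filter_upwards [e1, e2, e3, e4, e5] with ε h1 h2 h3 h4 h5
    exact miwa_real_of_injective hd₁ hd₂ hd h1 h2 h3 h4 h5 w (R₁ ε) (R₂ ε) (R₃ ε)
      (fun _ => rfl) (fun _ => rfl) fun _ => rfl
  have hfin : L 0 = R 0 := tendsto_nhds_unique
    ((cL.mono_left nhdsWithin_le_nhds).congr' hLR) (cR.mono_left nhdsWithin_le_nhds)
  simpa only [L, R, R₁, R₂, R₃, hT0, hS0] using hfin

theorem phi_ratio_shift {t s : ℝ} (ht3 : a₃ d₁ d₂ t ≠ 0) (hs3 : a₃ d₁ d₂ s ≠ 0)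
    (ht1 : a₁ d₁ d₂ t ≠ 0) (hs1 : a₁ d₁ d₂ s ≠ 0) (m n k l : ℤ) :
    φ d₁ d₂ (m + k) (n + l) t / φ d₁ d₂ (m + k) (n + l) s =
      φ d₁ d₂ m n t / φ d₁ d₂ m n s *
        (((a₃ d₁ d₂ t / a₃ d₁ d₂ s) / (a₁ d₁ d₂ t / a₁ d₁ d₂ s)) ^ k *
          (a₁ d₁ d₂ t / a₁ d₁ d₂ s) ^ l) := by
  simp only [φ]
  rw [zpow_add₀ (div_ne_zero ht3 ht1), zpow_add₀ (div_ne_zero hs3 hs1), zpow_add₀ ht1,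
    zpow_add₀ hs1, div_div_div_comm (a₃ d₁ d₂ t), div_zpow (a₃ d₁ d₂ t / _), div_zpow (a₁ d₁ d₂ t)]
  rw [div_mul_div_comm, div_mul_div_comm]
  congr 1 <;> ring

/-- The reduction: a step in direction 3 acts as two steps in direction 1 and one in direction 2. -/
theorem dispersion_ratio {t s : ℝ} (hs3 : a₃ d₁ d₂ s ≠ 0)
    (ht1 : a₁ d₁ d₂ t ≠ 0) (hs1 : a₁ d₁ d₂ s ≠ 0) (ht2 : a₂ d₁ d₂ t ≠ 0) (hs2 : a₂ d₁ d₂ s ≠ 0)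
    (h : ψ d₁ d₂ t = ψ d₁ d₂ s) :
    a₃ d₁ d₂ t / a₃ d₁ d₂ s =
      (a₁ d₁ d₂ t / a₁ d₁ d₂ s) ^ 2 * (a₂ d₁ d₂ t / a₂ d₁ d₂ s) := by
  simp only [ψ] at h
  rw [div_eq_div_iff (mul_ne_zero (pow_ne_zero 2 ht1) ht2)
    (mul_ne_zero (pow_ne_zero 2 hs1) hs2)] at h
  rw [div_pow, div_mul_div_comm, div_eq_div_iff hs3 (mul_ne_zero (pow_ne_zero 2 hs1) hs2), h]
  ring

/-- The soliton function solves the bilinear equation. -/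
theorem isSolution_soliton (hd₁ : 0 < d₁) (hd₂ : 0 < d₂) (hd : d₂ < 1) (c : Fin N → ℝ)
    {t s : Fin N → ℝ} (ht : ∀ i, IsRegularPoint d₁ d₂ (t i))
    (hs : ∀ i, IsRegularPoint d₁ d₂ (s i)) (hts : ∀ i j, i ≠ j → t i ≠ s j)
    (hψ : ∀ i, ψ d₁ d₂ (t i) = ψ d₁ d₂ (s i)) :
    IsSolution d₁ d₂ (soliton d₁ d₂ c t s) := by
  intro m n
  let r₁ : Fin N → ℝ := fun i => a₁ d₁ d₂ (t i) / a₁ d₁ d₂ (s i)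
  let r₂ : Fin N → ℝ := fun i => a₂ d₁ d₂ (t i) / a₂ d₁ d₂ (s i)
  let r₃ : Fin N → ℝ := fun i => a₃ d₁ d₂ (t i) / a₃ d₁ d₂ (s i)
  have t3 : ∀ i, a₃ d₁ d₂ (t i) ≠ 0 := fun i => (ht i).1.ne'
  have s3 : ∀ i, a₃ d₁ d₂ (s i) ≠ 0 := fun i => (hs i).1.ne'
  have t1 : ∀ i, a₁ d₁ d₂ (t i) ≠ 0 := fun i => (ht i).a₁_ne hd₁ hd₂ hd
  have s1 : ∀ i, a₁ d₁ d₂ (s i) ≠ 0 := fun i => (hs i).a₁_ne hd₁ hd₂ hd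
  have hr1 : ∀ i, r₁ i ≠ 0 := fun i => div_ne_zero (t1 i) (s1 i)
  have hr3 : ∀ i, r₃ i = r₁ i ^ 2 * r₂ i := fun i =>
    dispersion_ratio (s3 i) (t1 i) (s1 i) ((ht i).a₂_ne hd₂) ((hs i).a₂_ne hd₂) (hψ i)
  have hr31 : ∀ i, r₃ i / r₁ i = r₁ i * r₂ i := fun i => by
    rw [hr3, div_eq_iff (hr1 i)]; ring
  let w : Fin N → ℝ := fun i => c i * (φ d₁ d₂ (m - 1) n (t i) / φ d₁ d₂ (m - 1) n (s i))
  -- With base point `(m - 1, n)`, a unit step in `m` multiplies the weights by `r₃/r₁ = r₁r₂` and a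
  -- unit step in `n` by `r₁`. The eight Miwa factors then land on the eight lattice points of the
  -- equation.
  have hsol : ∀ k l : ℤ, soliton d₁ d₂ c t s (m - 1 + k) (n + l) =
      tau (solitonCouplings d₁ d₂ t s) fun i => w i * ((r₁ i * r₂ i) ^ k * r₁ i ^ l) := by
    intro k l
    have : ∀ i, c i * (φ d₁ d₂ (m - 1 + k) (n + l) (t i) / φ d₁ d₂ (m - 1 + k) (n + l) (s i)) =
        w i * ((r₁ i * r₂ i) ^ k * r₁ i ^ l) := fun i => by
      rw [phi_ratio_shift (t3 i) (s3 i) (t1 i) (s1 i), ← mul_assoc, ← hr31]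
    simp only [soliton, tau, pairProd, solitonCouplings, this]
  have key := miwa_real hd₁ hd₂ hd ht hs hts w r₁ r₂ r₃ (fun _ => rfl) (fun _ => rfl) fun _ => rfl
  have f1 : soliton d₁ d₂ c t s (m - 1) n = tau (solitonCouplings d₁ d₂ t s) w := rfl
  have f2 : soliton d₁ d₂ c t s (m + 1) (n + 1) =
      tau (solitonCouplings d₁ d₂ t s) fun i => w i * (r₁ i * r₂ i * r₃ i) := by
    rw [show m + 1 = m - 1 + 2 by ring, hsol]
    congr 1; funext i
    rw [hr3, zpow_one, zpow_ofNat]; ring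
  have f3 : soliton d₁ d₂ c t s (m + 1) n =
      tau (solitonCouplings d₁ d₂ t s) fun i => w i * (r₂ i * r₃ i) := by
    rw [show m + 1 = m - 1 + 2 by ring, ← add_zero n, hsol]
    congr 1; funext i
    rw [hr3, zpow_zero, zpow_ofNat]; ring
  have f4 : soliton d₁ d₂ c t s (m - 1) (n + 1) =
      tau (solitonCouplings d₁ d₂ t s) fun i => w i * r₁ i := by
    rw [← add_zero (m - 1), hsol]
    congr 1; funext i
    rw [zpow_zero, zpow_one, one_mul]
  have f5 : soliton d₁ d₂ c t s m (n - 1) =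
      tau (solitonCouplings d₁ d₂ t s) fun i => w i * r₂ i := by
    rw [show m = m - 1 + 1 by ring, sub_eq_add_neg n, hsol]
    congr 1; funext i
    rw [zpow_one, zpow_neg_one, mul_comm (r₁ i), mul_inv_cancel_right₀ (hr1 i)]
  have f6 : soliton d₁ d₂ c t s m (n + 2) =
      tau (solitonCouplings d₁ d₂ t s) fun i => w i * (r₁ i * r₃ i) := by
    rw [show m = m - 1 + 1 by ring, hsol]
    congr 1; funext i
    rw [hr3, zpow_one, zpow_ofNat]; ring
  have f7 : soliton d₁ d₂ c t s m n =
      tau (solitonCouplings d₁ d₂ t s) fun i => w i * (r₁ i * r₂ i) := by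
    rw [show m = m - 1 + 1 by ring, ← add_zero n, hsol]
    congr 1; funext i
    rw [zpow_one, zpow_zero, mul_one]
  have f8 : soliton d₁ d₂ c t s m (n + 1) =
      tau (solitonCouplings d₁ d₂ t s) fun i => w i * r₃ i := by
    rw [show m = m - 1 + 1 by ring, hsol]
    congr 1; funext i
    rw [hr3, zpow_one, zpow_one]; ring
  rw [f1, f2, f3, f4, f5, f6, f7, f8]
  linear_combination key

end Solution

end

section

open Set Filter Topology

/-! ### Quartics with four known real roots -/

/-- The difference of the two sides is a cubic with four distinct zeros. -/
theorem quartic_eq_of_roots {a b c d e r₁ r₂ r₃ r₄ : ℝ} (h₁₂ : r₁ < r₂) (h₂₃ : r₂ < r₃)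
    (h₃₄ : r₃ < r₄)
    (hr : ∀ r, r = r₁ ∨ r = r₂ ∨ r = r₃ ∨ r = r₄ →
      a * r ^ 4 + b * r ^ 3 + c * r ^ 2 + d * r + e = 0) (t : ℝ) :
    a * t ^ 4 + b * t ^ 3 + c * t ^ 2 + d * t + e =
      a * ((t - r₁) * (t - r₂) * (t - r₃) * (t - r₄)) := by
  let P : Polynomial ℝ :=
    .C (b + a * (r₁ + r₂ + r₃ + r₄)) * .X ^ 3 +
    .C (c - a * (r₁ * r₂ + r₁ * r₃ + r₁ * r₄ + r₂ * r₃ + r₂ * r₄ + r₃ * r₄)) * .X ^ 2 +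
    .C (d + a * (r₁ * r₂ * r₃ + r₁ * r₂ * r₄ + r₁ * r₃ * r₄ + r₂ * r₃ * r₄)) * .X +
    .C (e - a * (r₁ * r₂ * r₃ * r₄))
  have hP : ∀ x, P.eval x = a * x ^ 4 + b * x ^ 3 + c * x ^ 2 + d * x + e -
      a * ((x - r₁) * (x - r₂) * (x - r₃) * (x - r₄)) := by
    intro x
    simp only [P, Polynomial.eval_add, Polynomial.eval_mul, Polynomial.eval_C, Polynomial.eval_pow,
      Polynomial.eval_X]
    ring
  have hmono : StrictMono ![r₁, r₂, r₃, r₄] := by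
    rw [Fin.strictMono_iff_lt_succ]
    intro i
    fin_cases i
    exacts [h₁₂, h₂₃, h₃₄]
  have hzero : P = 0 := by
    refine Polynomial.eq_zero_of_natDegree_lt_card_of_eval_eq_zero P hmono.injective ?_ ?_
    · intro i
      fin_cases i <;> simp [hP, hr]
    · exact Polynomial.natDegree_cubic_le.trans_lt (by simp)
  have := hP t
  rw [hzero, Polynomial.eval_zero] at this
  linarith

theorem quartic_pos_of_large {a b c d e t : ℝ} (ht : 1 ≤ |t|)
    (hS : |b| + |c| + |d| + |e| < a * |t|) :
    0 < a * t ^ 4 + b * t ^ 3 + c * t ^ 2 + d * t + e := by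
  have h0 : 0 < |t| := zero_lt_one.trans_le ht
  have hb : |b * t ^ 3| ≤ |b| * |t| ^ 3 := by rw [abs_mul, abs_pow]
  have hc : |c * t ^ 2| ≤ |c| * |t| ^ 3 := by
    rw [abs_mul, abs_pow]
    exact mul_le_mul_of_nonneg_left (pow_le_pow_right₀ ht (by norm_num)) (abs_nonneg _)
  have hd : |d * t| ≤ |d| * |t| ^ 3 := by
    rw [abs_mul]
    exact mul_le_mul_of_nonneg_left (le_self_pow₀ ht (by norm_num)) (abs_nonneg _)
  have he : |e| ≤ |e| * |t| ^ 3 := le_mul_of_one_le_right (abs_nonneg _) (one_le_pow₀ ht)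
  have ha : a * t ^ 4 = a * |t| * |t| ^ 3 := by
    rw [mul_assoc, ← pow_succ', Even.pow_abs (by decide)]
  have hpos : 0 < (a * |t| - (|b| + |c| + |d| + |e|)) * |t| ^ 3 :=
    mul_pos (sub_pos.2 hS) (pow_pos h0 3)
  have := neg_abs_le (b * t ^ 3)
  have := neg_abs_le (c * t ^ 2)
  have := neg_abs_le (d * t)
  have := neg_abs_le e
  nlinarith

/-! ### The critical points of the dispersion function -/

/-- The numerator of the logarithmic derivative of the dispersion function. -/
def critPoly (z₁ z₂ z₃ z₄ t : ℝ) : ℝ :=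
  (z₁ - t) * (z₂ + t) * (z₂ * z₄ + z₃ * t) * (z₁ * z₄ - z₃ * t)
    - 2 * t * (z₂ + t) * (z₂ * z₄ + z₃ * t) * (z₁ * z₄ - z₃ * t)
    + t * (z₁ - t) * (z₂ * z₄ + z₃ * t) * (z₁ * z₄ - z₃ * t)
    - 2 * z₃ * t * (z₁ - t) * (z₂ + t) * (z₁ * z₄ - z₃ * t)
    + z₃ * t * (z₁ - t) * (z₂ + t) * (z₂ * z₄ + z₃ * t)

theorem critPoly_eq_quartic (z₁ z₂ z₃ z₄ : ℝ) : ∃ b c d e : ℝ, ∀ t,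
    critPoly z₁ z₂ z₃ z₄ t = z₃ ^ 2 * t ^ 4 + b * t ^ 3 + c * t ^ 2 + d * t + e := by
  refine ⟨-4 * (z₃ * z₄ * (z₁ - z₂)) - z₃ ^ 2 * (2 * z₁ - 3 * z₂) +
      z₃ * ((z₁ - z₂) * 3 * z₃ - (z₂ - 2 * z₁) * z₄),
    -4 * (z₁ * z₂ * z₄ ^ 2) + z₃ * z₄ * (z₁ - z₂) * (2 * z₁ - 3 * z₂) - z₃ ^ 2 * (z₁ * z₂) +
      z₃ * (z₁ * z₂ * 3 * z₃ + (z₁ - z₂) * ((z₂ - 2 * z₁) * z₄)),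
    z₁ * z₂ * z₄ ^ 2 * (2 * z₁ - 3 * z₂) + z₃ * z₄ * (z₁ - z₂) * (z₁ * z₂) +
      z₃ * (z₁ * z₂) * ((z₂ - 2 * z₁) * z₄),
    z₁ * z₂ * z₄ ^ 2 * (z₁ * z₂), fun t => ?_⟩
  simp only [critPoly]
  ring

theorem continuous_critPoly (z₁ z₂ z₃ z₄ : ℝ) : Continuous (critPoly z₁ z₂ z₃ z₄) := by
  unfold critPoly
  fun_prop

/-- The quartic is positive far to the left, negative at `-z₂`, positive at `0`, negative at `z₁`
and at `z₁z₄/z₃`, and positive far to the right. The four sign changes account for all its roots, so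
each interval contains exactly one. -/
theorem exists_critPoly_factorization {z₁ z₂ z₃ z₄ : ℝ} (h₁ : 0 < z₁) (h₂ : 0 < z₂) (h₃ : 0 < z₃)
    (h₃₄ : z₃ < z₄) :
    ∃ r₁ r₂ r₃ r₄ : ℝ, r₁ < 0 ∧ r₂ < 0 ∧ 0 < r₃ ∧ r₃ < z₁ ∧ z₁ * z₄ / z₃ < r₄ ∧
      ∀ t, critPoly z₁ z₂ z₃ z₄ t = z₃ ^ 2 * ((t - r₁) * (t - r₂) * (t - r₃) * (t - r₄)) := by
  have h₄ : 0 < z₄ := h₃.trans h₃₄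
  have hq : 1 < z₄ / z₃ := (one_lt_div h₃).2 h₃₄
  obtain ⟨b, c, d, e, hQ⟩ := critPoly_eq_quartic z₁ z₂ z₃ z₄
  have hcont := continuous_critPoly z₁ z₂ z₃ z₄
  -- The bound required by `quartic_pos_of_large`; the `+ 1` makes its inequality strict.
  set M : ℝ := max 1 ((|b| + |c| + |d| + |e| + 1) / z₃ ^ 2) with hM
  have hlarge : ∀ t, M ≤ |t| → 0 < critPoly z₁ z₂ z₃ z₄ t := by
    intro t ht
    rw [hQ]
    refine quartic_pos_of_large ((le_max_left _ _).trans ht) ?_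
    have := (div_le_iff₀' (pow_pos h₃ 2)).1 ((le_max_right _ _).trans ht)
    linarith
  have q0 : 0 < critPoly z₁ z₂ z₃ z₄ 0 := by
    have : critPoly z₁ z₂ z₃ z₄ 0 = z₁ * z₂ * (z₂ * z₄) * (z₁ * z₄) := by
      simp only [critPoly]; ring
    rw [this]; positivity
  have q1 : critPoly z₁ z₂ z₃ z₄ z₁ < 0 := by
    have : critPoly z₁ z₂ z₃ z₄ z₁ =
        -(2 * z₁ * (z₂ + z₁) * (z₂ * z₄ + z₃ * z₁) * (z₁ * (z₄ - z₃))) := by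
      simp only [critPoly]; ring
    have h34 := sub_pos.2 h₃₄
    rw [this]
    exact neg_neg_of_pos (by positivity)
  have q2 : critPoly z₁ z₂ z₃ z₄ (-z₂) < 0 := by
    have : critPoly z₁ z₂ z₃ z₄ (-z₂) =
        -(z₂ * (z₁ + z₂) * (z₂ * (z₄ - z₃)) * (z₁ * z₄ + z₃ * z₂)) := by
      simp only [critPoly]; ring
    have h34 := sub_pos.2 h₃₄
    rw [this]
    exact neg_neg_of_pos (by positivity)
  have hg : z₁ < z₁ * z₄ / z₃ := by rw [mul_div_assoc]; exact lt_mul_of_one_lt_right h₁ hq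
  have qg : critPoly z₁ z₂ z₃ z₄ (z₁ * z₄ / z₃) < 0 := by
    set g := z₁ * z₄ / z₃ with hgdef
    have hz : z₁ * z₄ - z₃ * g = 0 := by rw [hgdef, mul_div_cancel₀ _ h₃.ne', sub_self]
    have : critPoly z₁ z₂ z₃ z₄ g = -(z₃ * g * (g - z₁) * (z₂ + g) * (z₂ * z₄ + z₃ * g)) := by
      simp only [critPoly, hz]; ring
    have hg0 : 0 < g := h₁.trans hg
    have := sub_pos.2 hg
    rw [‹critPoly z₁ z₂ z₃ z₄ g = _›]
    exact neg_neg_of_pos (by positivity)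
  set x : ℝ := -(M + z₂) with hx
  have hM0 : 0 < M := zero_lt_one.trans_le (le_max_left _ _)
  have hxlt : x < -z₂ := by linarith
  have qx : 0 < critPoly z₁ z₂ z₃ z₄ x :=
    hlarge x (by rw [hx, abs_neg, abs_of_pos (by positivity)]; linarith)
  set y : ℝ := M + z₁ * z₄ / z₃ with hy
  have hylt : z₁ * z₄ / z₃ < y := by linarith
  have qy : 0 < critPoly z₁ z₂ z₃ z₄ y :=
    hlarge y (by rw [hy, abs_of_pos (by positivity)]; linarith)
  obtain ⟨r₁, ⟨-, hr₁⟩, hr₁'⟩ := intermediate_value_Ioo' hxlt.le hcont.continuousOn ⟨q2, qx⟩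
  obtain ⟨r₂, ⟨hr₂, hr₂0⟩, hr₂'⟩ :=
    intermediate_value_Ioo (neg_lt_zero.2 h₂).le hcont.continuousOn ⟨q2, q0⟩
  obtain ⟨r₃, ⟨hr₃, hr₃1⟩, hr₃'⟩ := intermediate_value_Ioo' h₁.le hcont.continuousOn ⟨q1, q0⟩
  obtain ⟨r₄, ⟨hr₄, -⟩, hr₄'⟩ := intermediate_value_Ioo hylt.le hcont.continuousOn ⟨qg, qy⟩
  refine ⟨r₁, r₂, r₃, r₄, by linarith, hr₂0, hr₃, hr₃1, hr₄, fun t => ?_⟩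
  rw [hQ]
  refine quartic_eq_of_roots (hr₁.trans hr₂) (hr₂0.trans hr₃) (hr₃1.trans (hg.trans hr₄)) ?_ t
  rintro r (rfl | rfl | rfl | rfl) <;> rwa [← hQ]

/-! ### The derivative of the dispersion function -/

section Psi

variable {d₁ d₂ : ℝ}

theorem ψ_eq (d₁ d₂ t : ℝ) : ψ d₁ d₂ t =
    t * (z₁ d₁ d₂ - t) ^ 2 * (z₂ d₁ d₂ + t) /
      ((z₂ d₁ d₂ * z₄ d₁ d₂ + z₃ d₁ d₂ * t) ^ 2 * (z₁ d₁ d₂ * z₄ d₁ d₂ - z₃ d₁ d₂ * t)) := by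
  simp only [ψ, a₁, a₂, a₃]
  rw [div_pow, div_mul_div_comm, div_div_eq_mul_div, mul_assoc]

theorem hasDerivAt_ψ {t : ℝ} (hA : z₂ d₁ d₂ * z₄ d₁ d₂ + z₃ d₁ d₂ * t ≠ 0)
    (hB : z₁ d₁ d₂ * z₄ d₁ d₂ - z₃ d₁ d₂ * t ≠ 0) :
    HasDerivAt (ψ d₁ d₂)
      ((z₁ d₁ d₂ - t) * critPoly (z₁ d₁ d₂) (z₂ d₁ d₂) (z₃ d₁ d₂) (z₄ d₁ d₂) t /
        ((z₂ d₁ d₂ * z₄ d₁ d₂ + z₃ d₁ d₂ * t) ^ 3 *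
          (z₁ d₁ d₂ * z₄ d₁ d₂ - z₃ d₁ d₂ * t) ^ 2)) t := by
  rw [show ψ d₁ d₂ = _ from funext (ψ_eq d₁ d₂)]
  generalize z₁ d₁ d₂ = z₁, z₂ d₁ d₂ = z₂, z₃ d₁ d₂ = z₃, z₄ d₁ d₂ = z₄ at *
  have i := hasDerivAt_id' t
  have hnum := (i.mul ((i.const_sub z₁).pow 2)).mul (i.const_add z₂)
  have hden := (((i.const_mul z₃).const_add (z₂ * z₄)).pow 2).mul
    ((i.const_mul z₃).const_sub (z₁ * z₄))
  refine (hnum.div hden (mul_ne_zero (pow_ne_zero 2 hA) hB)).congr_deriv ?_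
  simp only [Pi.mul_apply, Pi.pow_apply, critPoly]
  rw [div_eq_div_iff (pow_ne_zero 2 (mul_ne_zero (pow_ne_zero 2 hA) hB))
    (mul_ne_zero (pow_ne_zero 3 hA) (pow_ne_zero 2 hB))]
  push_cast
  ring

end Psi

end

section

open Set Filter Topology

/-! ### Unimodal functions -/

section Unimodal

/-- `f` increases strictly up to `α` and decreases strictly after it. -/
structure IsUnimodalOn (f : ℝ → ℝ) (J : Set ℝ) (α : ℝ) : Prop where
  mem : α ∈ J
  strictMonoOn : StrictMonoOn f (J ∩ Iic α)
  strictAntiOn : StrictAntiOn f (J ∩ Ici α)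

variable {f : ℝ → ℝ} {J : Set ℝ} {α : ℝ}

theorem isUnimodalOn_of_deriv (hJ : IsOpen J) (hJc : Convex ℝ J) (hα : α ∈ J)
    (hf : ContinuousOn f J) (hpos : ∀ t ∈ J, t < α → 0 < deriv f t)
    (hneg : ∀ t ∈ J, α < t → deriv f t < 0) : IsUnimodalOn f J α := by
  refine ⟨hα, strictMonoOn_of_deriv_pos (hJc.inter (convex_Iic α))
    (hf.mono inter_subset_left) fun x hx => ?_, strictAntiOn_of_deriv_neg
    (hJc.inter (convex_Ici α)) (hf.mono inter_subset_left) fun x hx => ?_⟩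
  · rw [interior_inter, interior_Iic, hJ.interior_eq] at hx
    exact hpos x hx.1 hx.2
  · rw [interior_inter, interior_Ici, hJ.interior_eq] at hx
    exact hneg x hx.1 hx.2

/-- The middle point shares a monotone branch with the left or the right point. -/
theorem IsUnimodalOn.min_lt (h : IsUnimodalOn f J α) {x y z : ℝ} (hx : x ∈ J) (hy : y ∈ J)
    (hz : z ∈ J) (hxy : x < y) (hyz : y < z) : min (f x) (f z) < f y := by
  rcases le_total y α with hyα | hyα
  · exact (min_le_left _ _).trans_lt (h.strictMonoOn ⟨hx, hxy.le.trans hyα⟩ ⟨hy, hyα⟩ hxy)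
  · exact (min_le_right _ _).trans_lt (h.strictAntiOn ⟨hy, hyα⟩ ⟨hz, hyα.trans hyz.le⟩ hyz)

/-- Pairs of points with equal values are nested. -/
theorem IsUnimodalOn.nested (h : IsUnimodalOn f J α) {t s t' s' : ℝ} (ht : t ∈ J) (hs : s ∈ J)
    (ht' : t' ∈ J) (hs' : s' ∈ J) (hts : f t = f s) (hts' : f t' = f s') :
    0 ≤ ((t - t') * (t - s')) * ((s - t') * (s - s')) := by
  wlog hlt : t' ≤ s' generalizing t' s'
  · have := this hs' ht' hts'.symm (le_of_not_ge hlt)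
    rwa [mul_comm (t - s'), mul_comm (s - s')] at this
  rcases hlt.eq_or_lt with rfl | hlt
  · exact mul_nonneg (mul_self_nonneg _) (mul_self_nonneg _)
  have inside : ∀ x ∈ J, t' < x → x < s' → f t' < f x := fun x hx h1 h2 => by
    simpa [hts'] using h.min_lt ht' hx hs' h1 h2
  have left : ∀ x ∈ J, x < t' → f x < f t' := fun x hx h1 => by
    have := h.min_lt hx ht' hs' h1 hlt
    rwa [← hts', min_lt_iff, or_iff_left (lt_irrefl _)] at this
  have right : ∀ x ∈ J, s' < x → f x < f t' := fun x hx h1 => by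
    have := h.min_lt ht' hs' hx hlt h1
    rwa [← hts', min_lt_iff, or_iff_right (lt_irrefl _)] at this
  have neg : ∀ x ∈ J, f t' ≤ f x → (x - t') * (x - s') ≤ 0 := fun x hx hle =>
    mul_nonpos_of_nonneg_of_nonpos (sub_nonneg.2 (le_of_not_gt fun h1 => (left x hx h1).not_ge hle))
      (sub_nonpos.2 (le_of_not_gt fun h1 => (right x hx h1).not_ge hle))
  have pos : ∀ x ∈ J, f x ≤ f t' → 0 ≤ (x - t') * (x - s') := by
    intro x hx hle
    rcases le_or_gt x t' with h1 | h1
    · exact mul_nonneg_of_nonpos_of_nonpos (by linarith) (by linarith)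
    · have h2 : s' ≤ x := le_of_not_gt fun h2 => (inside x hx h1 h2).not_ge hle
      exact mul_nonneg (by linarith) (by linarith)
  -- The pair at the higher level lies within the closed interval spanned by the other pair, so both
  -- inner products have the same sign.
  rcases le_total (f t') (f t) with hle | hle
  · exact mul_nonneg_of_nonpos_of_nonpos (neg t ht hle) (neg s hs (hts ▸ hle))
  · exact mul_nonneg (pos t ht hle) (pos s hs (hts ▸ hle))

/-- If `f` gets below every one of its values near both ends of `J`, then every point other than
the maximum has a unique partner with the same value. -/
theorem IsUnimodalOn.existsUnique_partner (h : IsUnimodalOn f J α) (hJ : J.OrdConnected)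
    (hf : ContinuousOn f J) (hleft : ∀ t ∈ J, ∃ x ∈ J, x < α ∧ f x < f t)
    (hright : ∀ t ∈ J, ∃ y ∈ J, α < y ∧ f y < f t) {t : ℝ} (ht : t ∈ J) (hne : t ≠ α) :
    ∃! s, s ∈ J ∧ s ≠ t ∧ f t = f s := by
  rcases hne.lt_or_gt with hlt | hlt
  · obtain ⟨y, hy, hαy, hfy⟩ := hright t ht
    have hsub : Icc α y ⊆ J := hJ.out h.mem hy
    have hfα : f t < f α := h.strictMonoOn ⟨ht, hlt.le⟩ ⟨h.mem, self_mem_Iic⟩ hlt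
    obtain ⟨s, hs, hfs⟩ := intermediate_value_Icc' hαy.le (hf.mono hsub) ⟨hfy.le, hfα.le⟩
    refine ⟨s, ⟨hsub hs, (hlt.trans_le hs.1).ne', hfs.symm⟩, ?_⟩
    rintro s' ⟨hs', hs't, hfs'⟩
    rcases le_total s' α with hle | hle
    · exact absurd (h.strictMonoOn.injOn ⟨hs', hle⟩ ⟨ht, hlt.le⟩ hfs'.symm) hs't
    · exact h.strictAntiOn.injOn ⟨hs', hle⟩ ⟨hsub hs, hs.1⟩ (hfs'.symm.trans hfs.symm)
  · obtain ⟨x, hx, hxα, hfx⟩ := hleft t ht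
    have hsub : Icc x α ⊆ J := hJ.out hx h.mem
    have hfα : f t < f α := h.strictAntiOn ⟨h.mem, self_mem_Ici⟩ ⟨ht, hlt.le⟩ hlt
    obtain ⟨s, hs, hfs⟩ := intermediate_value_Icc hxα.le (hf.mono hsub) ⟨hfx.le, hfα.le⟩
    refine ⟨s, ⟨hsub hs, (hs.2.trans_lt hlt).ne, hfs.symm⟩, ?_⟩
    rintro s' ⟨hs', hs't, hfs'⟩
    rcases le_total s' α with hle | hle
    · exact h.strictMonoOn.injOn ⟨hs', hle⟩ ⟨hsub hs, hs.2⟩ (hfs'.symm.trans hfs.symm)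
    · exact absurd (h.strictAntiOn.injOn ⟨hs', hle⟩ ⟨ht, hlt.le⟩ hfs'.symm) hs't

end Unimodal

/-! ### The dispersion function on the two intervals -/

theorem tendsto_linear_div_linear {a b c d : ℝ} (hd : d ≠ 0) :
    Tendsto (fun t : ℝ => (a + b * t) / (c + d * t)) atTop (𝓝 (b / d)) := by
  have h : ∀ u v : ℝ, Tendsto (fun t : ℝ => u / t + v) atTop (𝓝 v) := fun u v => by
    simpa using (tendsto_const_nhds.div_atTop tendsto_id).add_const v
  refine ((h a b).div (h c d) hd).congr' ?_
  filter_upwards [eventually_ne_atTop (0 : ℝ)] with t ht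
  simp only [Pi.div_apply]
  rw [div_add' _ _ _ ht, div_add' _ _ _ ht, div_div_div_cancel_right₀ ht]

section Psi

variable {d₁ d₂ : ℝ}

theorem z₁_lt_left_J₁ (hd₁ : 0 < d₁) (hd₂ : 0 < d₂) (hd : d₂ < 1) :
    d₁ < z₁ d₁ d₂ * z₄ d₁ d₂ / z₃ d₁ d₂ := by
  simp only [z₁, z₃, z₄]
  rw [lt_div_iff₀ (sub_pos.2 hd)]
  exact mul_lt_mul_of_pos_left (by linarith) hd₁

theorem pos_of_mem_J₁ (hd₁ : 0 < d₁) (hd₂ : 0 < d₂) (hd : d₂ < 1) {t : ℝ} (ht : t ∈ J₁ d₁ d₂) :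
    0 < t :=
  (hd₁.trans (z₁_lt_left_J₁ hd₁ hd₂ hd)).trans ht

theorem A_pos (hd₁ : 0 < d₁) (hd₂ : 0 < d₂) (hd : d₂ < 1) {t : ℝ} (ht : 0 ≤ t) :
    0 < z₂ d₁ d₂ * z₄ d₁ d₂ + z₃ d₁ d₂ * t := by
  have hd' : 0 < 1 - d₂ := sub_pos.2 hd
  simp only [z₂, z₃, z₄]
  positivity

theorem B_neg_of_mem_J₁ (hd : d₂ < 1) {t : ℝ} (ht : t ∈ J₁ d₁ d₂) :
    z₁ d₁ d₂ * z₄ d₁ d₂ - z₃ d₁ d₂ * t < 0 :=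
  sub_neg.2 ((div_lt_iff₀' (sub_pos.2 hd)).1 ht)

theorem B_pos_of_le_z₁ (hd₁ : 0 < d₁) (hd₂ : 0 < d₂) (hd : d₂ < 1) {t : ℝ} (ht : t ≤ d₁) :
    0 < z₁ d₁ d₂ * z₄ d₁ d₂ - z₃ d₁ d₂ * t :=
  sub_pos.2 ((lt_div_iff₀' (sub_pos.2 hd)).1 (ht.trans_lt (z₁_lt_left_J₁ hd₁ hd₂ hd)))

theorem isRegularPoint_of_mem (hd₁ : 0 < d₁) (hd₂ : 0 < d₂) (hd : d₂ < 1) {t : ℝ}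
    (ht : t ∈ J₁ d₁ d₂ ∨ t ∈ J₂ d₁ d₂) : IsRegularPoint d₁ d₂ t := by
  rcases ht with ht | ht
  · exact ⟨pos_of_mem_J₁ hd₁ hd₂ hd ht, ((z₁_lt_left_J₁ hd₁ hd₂ hd).trans ht).ne,
      (B_neg_of_mem_J₁ hd ht).ne⟩
  · exact ⟨ht.1, ht.2.ne', (B_pos_of_le_z₁ hd₁ hd₂ hd ht.2.le).ne'⟩

theorem hasDerivAt_ψ_of_mem (hd₁ : 0 < d₁) (hd₂ : 0 < d₂) (hd : d₂ < 1) {t : ℝ}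
    (ht : t ∈ J₁ d₁ d₂ ∨ t ∈ J₂ d₁ d₂) :
    HasDerivAt (ψ d₁ d₂)
      ((z₁ d₁ d₂ - t) * critPoly (z₁ d₁ d₂) (z₂ d₁ d₂) (z₃ d₁ d₂) (z₄ d₁ d₂) t /
        ((z₂ d₁ d₂ * z₄ d₁ d₂ + z₃ d₁ d₂ * t) ^ 3 *
          (z₁ d₁ d₂ * z₄ d₁ d₂ - z₃ d₁ d₂ * t) ^ 2)) t := by
  have h := isRegularPoint_of_mem hd₁ hd₂ hd ht
  exact hasDerivAt_ψ (A_pos hd₁ hd₂ hd h.1.le).ne' h.2.2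

theorem continuousOn_ψ (hd₁ : 0 < d₁) (hd₂ : 0 < d₂) (hd : d₂ < 1) {J : Set ℝ}
    (hJ : J = J₁ d₁ d₂ ∨ J = J₂ d₁ d₂) : ContinuousOn (ψ d₁ d₂) J := by
  intro t ht
  refine (hasDerivAt_ψ_of_mem hd₁ hd₂ hd ?_).continuousAt.continuousWithinAt
  rcases hJ with rfl | rfl
  exacts [Or.inl ht, Or.inr ht]

/-- On each interval `ψ'` has one zero, and it changes sign there from positive to negative. -/
theorem exists_sign_change (hd₁ : 0 < d₁) (hd₂ : 0 < d₂) (hd : d₂ < 1) {J : Set ℝ}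
    (hJ : J = J₁ d₁ d₂ ∨ J = J₂ d₁ d₂) :
    ∃ α ∈ J, deriv (ψ d₁ d₂) α = 0 ∧ (∀ t ∈ J, t < α → 0 < deriv (ψ d₁ d₂) t) ∧
      ∀ t ∈ J, α < t → deriv (ψ d₁ d₂) t < 0 := by
  have hd' : 0 < 1 - d₂ := sub_pos.2 hd
  obtain ⟨r₁, r₂, r₃, r₄, h1, h2, h3, h3', h4, hQ⟩ :=
    exists_critPoly_factorization (z₁ := z₁ d₁ d₂) (z₂ := z₂ d₁ d₂) (z₃ := z₃ d₁ d₂)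
      (z₄ := z₄ d₁ d₂) hd₁ hd₂ hd' (by simp only [z₃, z₄]; linarith)
  have hg := z₁_lt_left_J₁ hd₁ hd₂ hd
  have hz3 : 0 < z₃ d₁ d₂ ^ 2 := pow_pos hd' 2
  -- The negative roots `r₁`, `r₂` contribute positive factors, so only `d₁ - t`, `t - r₃` and `t -
  -- r₄` decide the sign.
  have hder : ∀ t, t ∈ J₁ d₁ d₂ ∨ t ∈ J₂ d₁ d₂ → ∃ k > 0,
      deriv (ψ d₁ d₂) t = k * ((d₁ - t) * ((t - r₃) * (t - r₄))) := by
    intro t ht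
    have hreg := isRegularPoint_of_mem hd₁ hd₂ hd ht
    have hA := A_pos hd₁ hd₂ hd hreg.1.le
    have hB : 0 < (z₁ d₁ d₂ * z₄ d₁ d₂ - z₃ d₁ d₂ * t) ^ 2 := sq_pos_of_ne_zero hreg.2.2
    have ht0 := hreg.1
    have e1 : 0 < t - r₁ := by linarith
    have e2 : 0 < t - r₂ := by linarith
    refine ⟨z₃ d₁ d₂ ^ 2 * (t - r₁) * (t - r₂) / ((z₂ d₁ d₂ * z₄ d₁ d₂ + z₃ d₁ d₂ * t) ^ 3 *
      (z₁ d₁ d₂ * z₄ d₁ d₂ - z₃ d₁ d₂ * t) ^ 2), by positivity, ?_⟩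
    rw [(hasDerivAt_ψ_of_mem hd₁ hd₂ hd ht).deriv, hQ, div_mul_eq_mul_div]
    simp only [z₁]
    ring
  rcases hJ with rfl | rfl
  · have hlt : ∀ t ∈ J₁ d₁ d₂, d₁ - t < 0 ∧ 0 < t - r₃ := fun t ht =>
      have ht' : d₁ < t := hg.trans ht
      ⟨sub_neg.2 ht', sub_pos.2 (h3'.trans ht')⟩
    refine ⟨r₄, h4, ?_, fun t ht htr => ?_, fun t ht htr => ?_⟩
    · obtain ⟨k, -, hk⟩ := hder r₄ (Or.inl h4)
      rw [hk]; ring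
    · obtain ⟨k, hk0, hk⟩ := hder t (Or.inl ht)
      rw [hk]
      exact mul_pos hk0 (mul_pos_of_neg_of_neg (hlt t ht).1
        (mul_neg_of_pos_of_neg (hlt t ht).2 (sub_neg.2 htr)))
    · obtain ⟨k, hk0, hk⟩ := hder t (Or.inl ht)
      rw [hk]
      exact mul_neg_of_pos_of_neg hk0 (mul_neg_of_neg_of_pos (hlt t ht).1
        (mul_pos (hlt t ht).2 (sub_pos.2 htr)))
  · have hlt : ∀ t ∈ J₂ d₁ d₂, 0 < d₁ - t ∧ t - r₄ < 0 := fun t ht =>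
      ⟨sub_pos.2 ht.2, sub_neg.2 (LT.lt.trans ht.2 (hg.trans h4))⟩
    have hmem : r₃ ∈ J₂ d₁ d₂ := ⟨h3, h3'⟩
    refine ⟨r₃, hmem, ?_, fun t ht htr => ?_, fun t ht htr => ?_⟩
    · obtain ⟨k, -, hk⟩ := hder r₃ (Or.inr hmem)
      rw [hk]; ring
    · obtain ⟨k, hk0, hk⟩ := hder t (Or.inr ht)
      rw [hk]
      exact mul_pos hk0 (mul_pos (hlt t ht).1
        (mul_pos_of_neg_of_neg (sub_neg.2 htr) (hlt t ht).2))
    · obtain ⟨k, hk0, hk⟩ := hder t (Or.inr ht)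
      rw [hk]
      exact mul_neg_of_pos_of_neg hk0 (mul_neg_of_pos_of_neg (hlt t ht).1
        (mul_neg_of_pos_of_neg (sub_pos.2 htr) (hlt t ht).2))

theorem isOpen_of_eq_J {J : Set ℝ} (hJ : J = J₁ d₁ d₂ ∨ J = J₂ d₁ d₂) : IsOpen J := by
  rcases hJ with rfl | rfl
  exacts [isOpen_Ioi, isOpen_Ioo]

theorem convex_of_eq_J {J : Set ℝ} (hJ : J = J₁ d₁ d₂ ∨ J = J₂ d₁ d₂) : Convex ℝ J := by
  rcases hJ with rfl | rfl
  exacts [convex_Ioi _, convex_Ioo _ _]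

/-- At this endpoint `a₂` vanishes: `ψ` is a positive continuous factor times the inverse of a
quantity tending to `0` from below. -/
theorem tendsto_ψ_left_J₁ (hd₁ : 0 < d₁) (hd₂ : 0 < d₂) (hd : d₂ < 1) :
    Tendsto (ψ d₁ d₂) (𝓝[>] (z₁ d₁ d₂ * z₄ d₁ d₂ / z₃ d₁ d₂)) atBot := by
  have hd' : 0 < z₃ d₁ d₂ := sub_pos.2 hd
  have hg := z₁_lt_left_J₁ hd₁ hd₂ hd
  set g := z₁ d₁ d₂ * z₄ d₁ d₂ / z₃ d₁ d₂ with hgdef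
  have hg0 : 0 < g := hd₁.trans hg
  have hA := A_pos hd₁ hd₂ hd hg0.le
  have hz1 : z₁ d₁ d₂ - g ≠ 0 := (sub_neg.2 hg).ne
  have hz2 : 0 < z₂ d₁ d₂ + g := add_pos hd₂ hg0
  have hzero : z₁ d₁ d₂ * z₄ d₁ d₂ - z₃ d₁ d₂ * g = 0 := by
    rw [hgdef, mul_div_cancel₀ _ hd'.ne', sub_self]
  have hB : Tendsto (fun t => z₁ d₁ d₂ * z₄ d₁ d₂ - z₃ d₁ d₂ * t) (𝓝[>] g) (𝓝[<] 0) := by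
    refine tendsto_nhdsWithin_iff.2 ⟨?_, ?_⟩
    · have : ContinuousAt (fun t => z₁ d₁ d₂ * z₄ d₁ d₂ - z₃ d₁ d₂ * t) g := by fun_prop
      rw [ContinuousAt, hzero] at this
      exact this.mono_left nhdsWithin_le_nhds
    · filter_upwards [self_mem_nhdsWithin] with t ht
      exact B_neg_of_mem_J₁ hd ht
  have hN : ContinuousAt (fun t => t * (z₁ d₁ d₂ - t) ^ 2 * (z₂ d₁ d₂ + t) /
      (z₂ d₁ d₂ * z₄ d₁ d₂ + z₃ d₁ d₂ * t) ^ 2) g := by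
    refine ContinuousAt.div (by fun_prop) (by fun_prop) (pow_pos hA 2).ne'
  have hNpos : 0 < g * (z₁ d₁ d₂ - g) ^ 2 * (z₂ d₁ d₂ + g) /
      (z₂ d₁ d₂ * z₄ d₁ d₂ + z₃ d₁ d₂ * g) ^ 2 := by
    have := sq_pos_of_ne_zero hz1
    positivity
  refine (Tendsto.pos_mul_atBot hNpos (hN.mono_left nhdsWithin_le_nhds)
    (tendsto_inv_nhdsLT_zero.comp hB)).congr fun t => ?_
  rw [ψ_eq, Function.comp_apply, ← div_eq_mul_inv, div_div]

/-- At infinity `ψ(t)` behaves like `-t/z₃³`. -/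
theorem tendsto_ψ_atTop (hd : d₂ < 1) : Tendsto (ψ d₁ d₂) atTop atBot := by
  have hd' : 0 < z₃ d₁ d₂ := sub_pos.2 hd
  have h1 : Tendsto (fun t => (z₁ d₁ d₂ + -1 * t) / (z₂ d₁ d₂ * z₄ d₁ d₂ + z₃ d₁ d₂ * t)) atTop
      (𝓝 (-1 / z₃ d₁ d₂)) := tendsto_linear_div_linear hd'.ne'
  have h2 : Tendsto (fun t => (z₂ d₁ d₂ + 1 * t) / (z₁ d₁ d₂ * z₄ d₁ d₂ + -z₃ d₁ d₂ * t)) atTop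
      (𝓝 (1 / -z₃ d₁ d₂)) := tendsto_linear_div_linear (neg_ne_zero.2 hd'.ne')
  have hneg : (-1 / z₃ d₁ d₂) ^ 2 * (1 / -z₃ d₁ d₂) < 0 :=
    mul_neg_of_pos_of_neg (sq_pos_of_ne_zero (div_ne_zero (by norm_num) hd'.ne'))
      (div_neg_of_pos_of_neg one_pos (neg_neg_of_pos hd'))
  refine (Tendsto.neg_mul_atTop hneg ((h1.pow 2).mul h2) tendsto_id).congr fun t => ?_
  rw [ψ_eq, div_pow, div_mul_div_comm, id, div_mul_eq_mul_div]
  congr 1 <;> ring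

theorem ψ_pos_of_mem_J₂ (hd₁ : 0 < d₁) (hd₂ : 0 < d₂) (hd : d₂ < 1) {t : ℝ} (ht : t ∈ J₂ d₁ d₂) :
    0 < ψ d₁ d₂ t := by
  have ht0 : 0 < t := ht.1
  have hA := A_pos hd₁ hd₂ hd ht0.le
  have hB := B_pos_of_le_z₁ hd₁ hd₂ hd ht.2.le
  have h1 : 0 < z₁ d₁ d₂ - t := sub_pos.2 ht.2
  have h2 : 0 < z₂ d₁ d₂ + t := add_pos hd₂ ht0
  rw [ψ_eq]
  positivity

/-- Near both ends of `J` the function `ψ` gets below each of its values on `J`. -/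
theorem exists_ψ_lt (hd₁ : 0 < d₁) (hd₂ : 0 < d₂) (hd : d₂ < 1) {J : Set ℝ}
    (hJ : J = J₁ d₁ d₂ ∨ J = J₂ d₁ d₂) {α t : ℝ} (hα : α ∈ J) (ht : t ∈ J) :
    (∃ x ∈ J, x < α ∧ ψ d₁ d₂ x < ψ d₁ d₂ t) ∧ ∃ y ∈ J, α < y ∧ ψ d₁ d₂ y < ψ d₁ d₂ t := by
  rcases hJ with rfl | rfl
  · constructor
    · obtain ⟨x, hx, hlt⟩ := (Eventually.and (Ioo_mem_nhdsGT hα)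
        ((tendsto_ψ_left_J₁ hd₁ hd₂ hd).eventually_lt_atBot (ψ d₁ d₂ t))).exists
      exact ⟨x, hx.1, hx.2, hlt⟩
    · obtain ⟨y, hy, hlt⟩ := ((eventually_gt_atTop α).and
        ((tendsto_ψ_atTop hd).eventually_lt_atBot (ψ d₁ d₂ t))).exists
      exact ⟨y, LT.lt.trans hα hy, hy, hlt⟩
  · have hpos := ψ_pos_of_mem_J₂ hd₁ hd₂ hd ht
    -- Unlike on `J₁`, here `ψ` extends continuously to both endpoints with value `0`, while it is
    -- positive inside.
    have hcont : ∀ x, 0 ≤ x → x ≤ d₁ → ContinuousAt (ψ d₁ d₂) x := fun x hx hx1 =>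
      (hasDerivAt_ψ (A_pos hd₁ hd₂ hd hx).ne' (B_pos_of_le_z₁ hd₁ hd₂ hd hx1).ne').continuousAt
    have h0 : ψ d₁ d₂ 0 < ψ d₁ d₂ t := by
      rw [show ψ d₁ d₂ 0 = 0 by rw [ψ_eq]; simp]; exact hpos
    have h1 : ψ d₁ d₂ d₁ < ψ d₁ d₂ t := by
      rw [show ψ d₁ d₂ d₁ = 0 by rw [ψ_eq]; simp [z₁]]; exact hpos
    constructor
    · obtain ⟨x, hx, hlt⟩ := (Eventually.and (Ioo_mem_nhdsGT hα.1)
        (((hcont 0 le_rfl hd₁.le).eventually_lt_const h0).filter_mono nhdsWithin_le_nhds)).exists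
      exact ⟨x, ⟨hx.1, hx.2.trans hα.2⟩, hx.2, hlt⟩
    · obtain ⟨y, hy, hlt⟩ := (Eventually.and (Ioo_mem_nhdsLT hα.2)
        (((hcont d₁ hd₁.le le_rfl).eventually_lt_const h1).filter_mono nhdsWithin_le_nhds)).exists
      exact ⟨y, ⟨LT.lt.trans hα.1 hy.1, hy.2⟩, hy.1, hlt⟩

theorem exists_isUnimodalOn_ψ (hd₁ : 0 < d₁) (hd₂ : 0 < d₂) (hd : d₂ < 1) {J : Set ℝ}
    (hJ : J = J₁ d₁ d₂ ∨ J = J₂ d₁ d₂) : ∃ α, IsUnimodalOn (ψ d₁ d₂) J α := by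
  obtain ⟨α, hα, -, hpos, hneg⟩ := exists_sign_change hd₁ hd₂ hd hJ
  exact ⟨α, isUnimodalOn_of_deriv (isOpen_of_eq_J hJ) (convex_of_eq_J hJ) hα
    (continuousOn_ψ hd₁ hd₂ hd hJ) hpos hneg⟩

/-- Each interval has one critical point, and every other point has a unique partner. -/
theorem critical_point_and_partner (hd₁ : 0 < d₁) (hd₂ : 0 < d₂) (hd : d₂ < 1) {J : Set ℝ}
    (hJ : J = J₁ d₁ d₂ ∨ J = J₂ d₁ d₂) :
    (∃! α, α ∈ J ∧ deriv (ψ d₁ d₂) α = 0) ∧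
      ∀ t ∈ J, deriv (ψ d₁ d₂) t ≠ 0 → ∃! s, s ∈ J ∧ s ≠ t ∧ ψ d₁ d₂ t = ψ d₁ d₂ s := by
  obtain ⟨α, hα, hα0, hpos, hneg⟩ := exists_sign_change hd₁ hd₂ hd hJ
  have huni := isUnimodalOn_of_deriv (isOpen_of_eq_J hJ) (convex_of_eq_J hJ) hα
    (continuousOn_ψ hd₁ hd₂ hd hJ) hpos hneg
  refine ⟨⟨α, ⟨hα, hα0⟩, fun x hx => ?_⟩, fun t ht htne => ?_⟩
  · by_contra hne
    rcases lt_or_gt_of_ne hne with h | h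
    · exact (hpos x hx.1 h).ne' hx.2
    · exact (hneg x hx.1 h).ne hx.2
  · exact huni.existsUnique_partner (convex_of_eq_J hJ).ordConnected
      (continuousOn_ψ hd₁ hd₂ hd hJ) (fun t ht => (exists_ψ_lt hd₁ hd₂ hd hJ hα ht).1)
      (fun t ht => (exists_ψ_lt hd₁ hd₂ hd hJ hα ht).2) ht fun e => htne (e ▸ hα0)

/-! ### Positivity -/

/-- All denominators in `cf` are positive, so numerator times denominator of `b` has the sign of the
product of the four differences. A zero denominator makes `b` zero by convention. -/
theorem b_nonneg (hd₁ : 0 < d₁) (hd₂ : 0 < d₂) (hd : d₂ < 1) {t s t' s' : ℝ} (ht : 0 < t)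
    (hs : 0 < s) (ht' : 0 < t') (hs' : 0 < s')
    (h : 0 ≤ ((t - t') * (t - s')) * ((s - t') * (s - s'))) : 0 ≤ b d₁ d₂ t s t' s' := by
  have D := @cf_denom_pos d₁ d₂ hd₁ hd₂ hd
  have hmul : 0 ≤ (cf d₁ d₂ t t' * cf d₁ d₂ s s') * (cf d₁ d₂ s t' * cf d₁ d₂ t s') := by
    simp only [cf]
    rw [div_mul_div_comm, div_mul_div_comm, div_mul_div_comm]
    refine div_nonneg (by linarith) (mul_pos (mul_pos (D ht ht') (D hs hs'))
      (mul_pos (D hs ht') (D ht hs'))).le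
  exact div_nonneg_iff.2 (mul_nonneg_iff.1 hmul)

theorem b_nonneg_of_mem (hd₁ : 0 < d₁) (hd₂ : 0 < d₂) (hd : d₂ < 1) {t s t' s' : ℝ}
    (h : (t ∈ J₁ d₁ d₂ ∧ s ∈ J₁ d₁ d₂) ∨ (t ∈ J₂ d₁ d₂ ∧ s ∈ J₂ d₁ d₂))
    (h' : (t' ∈ J₁ d₁ d₂ ∧ s' ∈ J₁ d₁ d₂) ∨ (t' ∈ J₂ d₁ d₂ ∧ s' ∈ J₂ d₁ d₂))
    (hψ : ψ d₁ d₂ t = ψ d₁ d₂ s) (hψ' : ψ d₁ d₂ t' = ψ d₁ d₂ s') :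
    0 ≤ b d₁ d₂ t s t' s' := by
  have hpos : ∀ x, x ∈ J₁ d₁ d₂ ∨ x ∈ J₂ d₁ d₂ → 0 < x := fun x hx =>
    (isRegularPoint_of_mem hd₁ hd₂ hd hx).1
  have hlt : ∀ x ∈ J₁ d₁ d₂, ∀ y ∈ J₂ d₁ d₂, y < x := fun x hx y hy =>
    LT.lt.trans hy.2 ((z₁_lt_left_J₁ hd₁ hd₂ hd).trans hx)
  refine b_nonneg hd₁ hd₂ hd (hpos t (h.imp And.left And.left)) (hpos s (h.imp And.right And.right))
    (hpos t' (h'.imp And.left And.left)) (hpos s' (h'.imp And.right And.right)) ?_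
  -- Solitons in one interval are nested; for different intervals the four differences share one
  -- sign because `J₂` lies to the left of `J₁`.
  rcases h with ⟨ht, hs⟩ | ⟨ht, hs⟩ <;> rcases h' with ⟨ht', hs'⟩ | ⟨ht', hs'⟩
  · obtain ⟨α, hα⟩ := exists_isUnimodalOn_ψ hd₁ hd₂ hd (Or.inl rfl)
    exact hα.nested ht hs ht' hs' hψ hψ'
  · have := hlt t ht t' ht'
    have := hlt t ht s' hs'
    have := hlt s hs t' ht'
    have := hlt s hs s' hs'
    exact mul_nonneg (mul_nonneg (by linarith) (by linarith))
      (mul_nonneg (by linarith) (by linarith))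
  · have := hlt t' ht' t ht
    have := hlt t' ht' s hs
    have := hlt s' hs' t ht
    have := hlt s' hs' s hs
    exact mul_nonneg (mul_nonneg_of_nonpos_of_nonpos (by linarith) (by linarith))
      (mul_nonneg_of_nonpos_of_nonpos (by linarith) (by linarith))
  · obtain ⟨α, hα⟩ := exists_isUnimodalOn_ψ hd₁ hd₂ hd (Or.inr rfl)
    exact hα.nested ht hs ht' hs' hψ hψ'

theorem phi_ratio_pos (hd₁ : 0 < d₁) (hd₂ : 0 < d₂) (hd : d₂ < 1) {t s : ℝ}
    (h : (t ∈ J₁ d₁ d₂ ∧ s ∈ J₁ d₁ d₂) ∨ (t ∈ J₂ d₁ d₂ ∧ s ∈ J₂ d₁ d₂)) (m n : ℤ) :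
    0 < φ d₁ d₂ m n t / φ d₁ d₂ m n s := by
  have ht := isRegularPoint_of_mem hd₁ hd₂ hd (h.imp And.left And.left)
  have hs := isRegularPoint_of_mem hd₁ hd₂ hd (h.imp And.right And.right)
  have hAt := A_pos hd₁ hd₂ hd ht.1.le
  have hAs := A_pos hd₁ hd₂ hd hs.1.le
  have h1 : 0 < a₁ d₁ d₂ t / a₁ d₁ d₂ s := by
    rcases h with ⟨ht', hs'⟩ | ⟨ht', hs'⟩
    · have hg := z₁_lt_left_J₁ hd₁ hd₂ hd
      exact div_pos_of_neg_of_neg (div_neg_of_pos_of_neg hAt (sub_neg.2 (hg.trans ht')))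
        (div_neg_of_pos_of_neg hAs (sub_neg.2 (hg.trans hs')))
    · exact div_pos (div_pos hAt (sub_pos.2 ht'.2)) (div_pos hAs (sub_pos.2 hs'.2))
  have h3 : 0 < a₃ d₁ d₂ t / a₃ d₁ d₂ s := div_pos ht.1 hs.1
  -- Starting from `(0, 0)`, where `φ = 1`, the quotient becomes a product of powers of positive
  -- ratios. The ratio of the `a₁` values is positive because `a₁` has constant sign on each
  -- interval.
  have := phi_ratio_shift ht.1.ne' hs.1.ne' (ht.a₁_ne hd₁ hd₂ hd) (hs.a₁_ne hd₁ hd₂ hd) 0 0 m n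
  simp only [zero_add] at this
  rw [this]
  simp only [φ, zpow_zero, mul_one, div_one, one_mul]
  exact mul_pos (zpow_pos (div_pos h3 h1) m) (zpow_pos h1 n)

theorem soliton_pos (hd₁ : 0 < d₁) (hd₂ : 0 < d₂) (hd : d₂ < 1) {N : ℕ} {c t s : Fin N → ℝ}
    (h : ∀ i, (t i ∈ J₁ d₁ d₂ ∧ s i ∈ J₁ d₁ d₂) ∨ (t i ∈ J₂ d₁ d₂ ∧ s i ∈ J₂ d₁ d₂))
    (hψ : ∀ i, ψ d₁ d₂ (t i) = ψ d₁ d₂ (s i)) (hc : ∀ i, 0 < c i) (m n : ℤ) :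
    0 < soliton d₁ d₂ c t s m n := by
  refine Finset.sum_pos' (fun I _ => mul_nonneg ?_ ?_) ⟨∅, Finset.mem_univ _, by simp⟩
  · exact Finset.prod_nonneg fun i _ => (mul_pos (hc i) (phi_ratio_pos hd₁ hd₂ hd (h i) m n)).le
  · exact Finset.prod_nonneg fun i _ => Finset.prod_nonneg fun j _ =>
      b_nonneg_of_mem hd₁ hd₂ hd (h i) (h j) (hψ i) (hψ j)

theorem isSolution_zero_iff (d₁ : ℝ) (f : ℤ → ℤ → ℝ) :
    IsSolution d₁ 0 f ↔ IsDiscreteKdVSolution d₁ f := by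
  simp [IsSolution, IsDiscreteKdVSolution]

end Psi

end

end DMix

theorem mainTheorem2 (d₁ d₂ : ℝ) (hd₂ : 0 < d₂) (hd : d₂ < d₁) (hd₁ : d₁ < 1) :
    -- the soliton function solves the equation, and it is positive for positive `c`
    (∀ (N : ℕ) (c t s : Fin N → ℝ),
      (∀ i, (t i ∈ DMix.J₁ d₁ d₂ ∧ s i ∈ DMix.J₁ d₁ d₂) ∨
        (t i ∈ DMix.J₂ d₁ d₂ ∧ s i ∈ DMix.J₂ d₁ d₂)) →
      (∀ i, DMix.ψ d₁ d₂ (t i) = DMix.ψ d₁ d₂ (s i)) →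
      -- the denominators of the coupling factors do not vanish
      (∀ i j, i ≠ j → t i ≠ s j) →
      DMix.IsSolution d₁ d₂ (DMix.soliton d₁ d₂ c t s) ∧
        ((∀ i, 0 < c i) → ∀ m n : ℤ, 0 < DMix.soliton d₁ d₂ c t s m n)) ∧
    -- each interval has one critical point, and every other point has a unique partner
    (∀ J : Set ℝ, J = DMix.J₁ d₁ d₂ ∨ J = DMix.J₂ d₁ d₂ →
      (∃! α, α ∈ J ∧ deriv (DMix.ψ d₁ d₂) α = 0) ∧
        ∀ t ∈ J, deriv (DMix.ψ d₁ d₂) t ≠ 0 →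
          ∃! s, s ∈ J ∧ s ≠ t ∧ DMix.ψ d₁ d₂ t = DMix.ψ d₁ d₂ s) ∧
    -- at `d₂ = 0` the equation is the discrete KdV equation
    (∀ f : ℤ → ℤ → ℝ, DMix.IsSolution d₁ 0 f ↔ DMix.IsDiscreteKdVSolution d₁ f) := by
  have hd₁0 : 0 < d₁ := hd₂.trans hd
  have hd₂1 : d₂ < 1 := hd.trans hd₁
  refine ⟨fun N c t s hmem hψ hts => ⟨?_, fun hc m n =>
      DMix.soliton_pos hd₁0 hd₂ hd₂1 hmem hψ hc m n⟩,
    fun J hJ => DMix.critical_point_and_partner hd₁0 hd₂ hd₂1 hJ,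
    fun f => DMix.isSolution_zero_iff d₁ f⟩
  exact DMix.isSolution_soliton hd₁0 hd₂ hd₂1 c
    (fun i => DMix.isRegularPoint_of_mem hd₁0 hd₂ hd₂1 ((hmem i).imp And.left And.left))
    (fun i => DMix.isRegularPoint_of_mem hd₁0 hd₂ hd₂1 ((hmem i).imp And.right And.right)) hts hψ
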